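/- Let $k$ be a field and let $C$ be a coalgebra over $k$, with comultiplication $\Delta$ and counit $\varepsilon$. Write $G(C)$ for the set of group-like elements of $C$ (those $g$ with $\Delta(g)=g\otimes g$ and $\varepsilon(g)=1$). The coradical of a coalgebra is the sum of its simple subcoalgebras, and a coalgebra is pointed if its coradical is the linear span of its group-like elements. Let $\mathcal{H}(C)$ be Takeuchi's free Hopf algebra generated by $C$. That is, let $V=\bigoplus_{i\ge 0}V_i$ with $V_i=C$ for $i$ even and $V_i=C^{cop}$ for $i$ odd, and give the tensor algebra $T(V)$ the bialgebra structure that extends the coalgebra structure of $V$. Let $S$ be the algebra antiendomorphism of $T(V)$ that extends the shift $(x_0,x_1,\dots)\mapsto(0,x_0,x_1,\dots)$. Then $\mathcal{H}(C)=T(V)/I$, where $I$ is the two-sided ideal generated by the elements $(S*\mathrm{Id})(x)-\varepsilon(x)1$ and $(\mathrm{Id}*S)(x)-\varepsilon(x)1$ with $x\in V$, where $*$ denotes the convolution product; its antipode is induced by $S$. Let $i\colon C=V_0\to\mathcal{H}(C)$ be the canonical coalgebra map. For a subspace $W$ of an algebra and $n\ge 1$, let $W^n$ be the linear span of all products of at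 most $n$ elements of $W$ (the empty product $1$ included); write $C^n$ for $i(C)^n$. Suppose that $C$ is pointed. Then the following hold. (I) The Hopf algebra $\mathcal{H}(C)$ is pointed, and its coradical is equal to the subalgebra generated by the elements $i(g)$, $g\in G(C)$, and their inverses. This subalgebra is isomorphic to the group algebra $k\langle G(C)\rangle$ of the free group $\langle G(C)\rangle$ on the set $G(C)$: the homomorphism of bialgebras $k\langle G(C)\rangle\to\mathcal{H}(C)$ that sends each free generator $g\in G(C)$ to $i(g)$ exists, is injective, and has the coradical as its image. (II) For every $n\ge 1$, $C^n$ is a subcoalgebra of $\mathcal{H}(C)$, and every group-like element of $C^n$ is a product of at most $n$ elements of $i(G(C))$. -/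

import Mathlib

open Coalgebra TensorProduct

noncomputable section

namespace Takeuchi

universe u v

section Copies

variable (k : Type u) (C : Type v) [Field k] [AddCommGroup C] [Module k C]

/-- The `n`-th summand: a copy of `C`, which carries the comultiplication of `C` if `n` is even and
the opposite one if `n` is odd. -/
@[nolint unusedArguments]
def Copy (_k : Type u) (C : Type v) (_n : ℕ) : Type v := C

instance (n : ℕ) : AddCommGroup (Copy k C n) := inferInstanceAs (AddCommGroup C)

instance (n : ℕ) : Module k (Copy k C n) := inferInstanceAs (Module k C)

/-- The identity of `C`, as a linear map from one copy to another. -/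
def Copy.cast (m n : ℕ) : Copy k C m →ₗ[k] Copy k C n := (LinearMap.id : C →ₗ[k] C)

/-- The identity of `C`, as a linear map from `C` to a copy of it. -/
def Copy.mk (n : ℕ) : C →ₗ[k] Copy k C n := (LinearMap.id : C →ₗ[k] C)

variable [Coalgebra k C]

/-- The opposite comultiplication. -/
def comulCop : C →ₗ[k] C ⊗[k] C := (TensorProduct.comm k C C).toLinearMap ∘ₗ comul


theorem comulCop_coassoc :
    (TensorProduct.assoc k C C C).toLinearMap ∘ₗ (comulCop k C).rTensor C ∘ₗ comulCop k C =
      (comulCop k C).lTensor C ∘ₗ comulCop k C := by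
  ext x
  have h := sum_tmul_tmul_eq (R := k) (ℛ k x) (fun i => ℛ k ((ℛ k x).left i))
    (fun i => ℛ k ((ℛ k x).right i))
  have h2 := congrArg ((TensorProduct.assoc k C C C).toLinearMap ∘ₗ
    (TensorProduct.comm k C C).toLinearMap.rTensor C ∘ₗ
    (TensorProduct.comm k C (C ⊗[k] C)).toLinearMap) h
  simp only [map_sum, LinearMap.comp_apply, LinearEquiv.coe_coe, TensorProduct.comm_tmul,
    LinearMap.rTensor_tmul, TensorProduct.assoc_tmul] at h2
  simp only [comulCop, LinearMap.comp_apply, LinearEquiv.coe_coe]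
  rw [← (ℛ k x).eq]
  simp only [map_sum, TensorProduct.comm_tmul, LinearMap.rTensor_tmul, LinearMap.lTensor_tmul,
    LinearMap.comp_apply, LinearEquiv.coe_coe]
  rw [Finset.sum_congr rfl fun i _ => by
    rw [← (ℛ k ((ℛ k x).right i)).eq], eq_comm, Finset.sum_congr rfl fun i _ => by
    rw [← (ℛ k ((ℛ k x).left i)).eq]]
  simpa [TensorProduct.tmul_sum, TensorProduct.sum_tmul] using h2

theorem comulCop_rTensor_counit :
    (counit : C →ₗ[k] k).rTensor C ∘ₗ comulCop k C = TensorProduct.mk k _ _ 1 := by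
  ext x
  have h := congrArg (TensorProduct.comm k C k) (sum_tmul_counit_eq (ℛ k x))
  simp only [map_sum, TensorProduct.comm_tmul] at h
  simp only [comulCop, LinearMap.comp_apply, LinearEquiv.coe_coe]
  rw [← (ℛ k x).eq]
  simp only [map_sum, TensorProduct.comm_tmul, LinearMap.rTensor_tmul]
  exact h

theorem comulCop_lTensor_counit :
    (counit : C →ₗ[k] k).lTensor C ∘ₗ comulCop k C = (TensorProduct.mk k _ _).flip 1 := by
  ext x
  have h := congrArg (TensorProduct.comm k k C) (sum_counit_tmul_eq (ℛ k x))
  simp only [map_sum, TensorProduct.comm_tmul] at h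
  simp only [comulCop, LinearMap.comp_apply, LinearEquiv.coe_coe]
  rw [← (ℛ k x).eq]
  simp only [map_sum, TensorProduct.comm_tmul, LinearMap.lTensor_tmul]
  exact h

instance (n : ℕ) : CoalgebraStruct k (Copy k C n) where
  comul := if Even n then (comul : C →ₗ[k] C ⊗[k] C) else comulCop k C
  counit := (counit : C →ₗ[k] k)

theorem Copy.comul_of_even {n : ℕ} (h : Even n) :
    (comul : Copy k C n →ₗ[k] _) = (comul : C →ₗ[k] C ⊗[k] C) := if_pos h

theorem Copy.comul_of_not_even {n : ℕ} (h : ¬ Even n) :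
    (comul : Copy k C n →ₗ[k] _) = comulCop k C := if_neg h

instance (n : ℕ) : Coalgebra k (Copy k C n) where
  coassoc := by
    by_cases h : Even n
    · rw [Copy.comul_of_even k C h]; exact Coalgebra.coassoc (R := k) (A := C)
    · rw [Copy.comul_of_not_even k C h]; exact comulCop_coassoc k C
  rTensor_counit_comp_comul := by
    by_cases h : Even n
    · rw [Copy.comul_of_even k C h]; exact Coalgebra.rTensor_counit_comp_comul (R := k) (A := C)
    · rw [Copy.comul_of_not_even k C h]; exact comulCop_rTensor_counit k C
  lTensor_counit_comp_comul := by
    by_cases h : Even n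
    · rw [Copy.comul_of_even k C h]; exact Coalgebra.lTensor_counit_comp_comul (R := k) (A := C)
    · rw [Copy.comul_of_not_even k C h]; exact comulCop_lTensor_counit k C

/-- Passing to the next copy reverses the comultiplication. -/
theorem Copy.comul_cast_succ (n : ℕ) (x : Copy k C n) :
    comul (R := k) (Copy.cast k C n (n + 1) x) = TensorProduct.map (Copy.cast k C n (n + 1))
      (Copy.cast k C n (n + 1)) (TensorProduct.comm k _ _ (comul (R := k) x)) := by
  have hid : TensorProduct.map (Copy.cast k C n (n + 1)) (Copy.cast k C n (n + 1)) =
      (LinearMap.id : C ⊗[k] C →ₗ[k] C ⊗[k] C) := TensorProduct.map_id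
  rw [hid]
  by_cases h : Even n
  · have h' : ¬ Even (n + 1) := by simpa [Nat.even_add_one] using h
    rw [Copy.comul_of_even k C h, Copy.comul_of_not_even k C h']
    rfl
  · have h' : Even (n + 1) := by simpa [Nat.even_add_one] using h
    rw [Copy.comul_of_not_even k C h, Copy.comul_of_even k C h']
    exact ((TensorProduct.comm k C C).symm_apply_apply (comul (R := k) (A := C) x)).symm

end Copies

section General

variable {k : Type u} [Field k]

open WithConv in
/-- If `s` and `j` are convolution inverse to each other, then so are `(s ⊗ s) ∘ Δ^cop` and
`(j ⊗ j) ∘ Δ`. -/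
theorem conv_tensor {V : Type*} [AddCommGroup V] [Module k V] [Coalgebra k V]
    {Q : Type*} [Ring Q] [Algebra k Q] {j s : V →ₗ[k] Q}
    (hl : toConv s * toConv j = 1) (hr : toConv j * toConv s = 1) :
    toConv (TensorProduct.map s s ∘ₗ comulCop k V) *
        toConv (TensorProduct.map j j ∘ₗ comul) = 1 ∧
      toConv (TensorProduct.map j j ∘ₗ comul) *
        toConv (TensorProduct.map s s ∘ₗ comulCop k V) = 1 := by
  let L : Q →ₐ[k] Q ⊗[k] Q := Algebra.TensorProduct.includeLeft
  let R : Q →ₐ[k] Q ⊗[k] Q := Algebra.TensorProduct.includeRight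
  have conv_one : ∀ (h : Q →ₐ[k] Q ⊗[k] Q) (f g : V →ₗ[k] Q), toConv f * toConv g = 1 →
      toConv (h.toLinearMap ∘ₗ f) * toConv (h.toLinearMap ∘ₗ g) = 1 := by
    intro h f g hfg
    refine WithConv.ext (LinearMap.ext fun x => ?_)
    have h1 := congrArg (fun f => h (f x)) hfg
    simp only [(ℛ k x).convMul_apply, LinearMap.convOne_apply] at h1
    refine ((ℛ k x).convMul_apply _ _).trans ?_
    simpa using h1
  have e1 : toConv (TensorProduct.map j j ∘ₗ comul) =
      toConv (L.toLinearMap ∘ₗ j) * toConv (R.toLinearMap ∘ₗ j) := by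
    refine WithConv.ext (LinearMap.ext fun x => ?_)
    refine Eq.trans ?_ ((ℛ k x).convMul_apply _ _).symm
    simp only [LinearMap.comp_apply]
    rw [← (ℛ k x).eq]
    simp [L, R]
  have e2 : toConv (TensorProduct.map s s ∘ₗ comulCop k V) =
      toConv (R.toLinearMap ∘ₗ s) * toConv (L.toLinearMap ∘ₗ s) := by
    refine WithConv.ext (LinearMap.ext fun x => ?_)
    refine Eq.trans ?_ ((ℛ k x).convMul_apply _ _).symm
    simp only [LinearMap.comp_apply, comulCop]
    rw [← (ℛ k x).eq]
    simp [L, R]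
  have l1 := conv_one L s j hl
  have l2 := conv_one L j s hr
  have r1 := conv_one R s j hl
  have r2 := conv_one R j s hr
  constructor
  · rw [e1, e2, mul_assoc, ← mul_assoc (toConv (L.toLinearMap ∘ₗ s)), l1, one_mul, r1]
  · rw [e1, e2, mul_assoc, ← mul_assoc (toConv (R.toLinearMap ∘ₗ j)), r2, one_mul, l2]

variable {Q : Type*} [Ring Q] [Bialgebra k Q] {S : Q →ₗ[k] Q}

/-- The left antipode axiom for an antimultiplicative map passes to products. -/
theorem antipode_left_mul (hS : ∀ a b, S (a * b) = S b * S a) {a b : Q}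
    (ha : LinearMap.mul' k Q (S.rTensor Q (comul (R := k) a)) = algebraMap k Q (counit (R := k) a))
    (hb : LinearMap.mul' k Q (S.rTensor Q (comul (R := k) b)) =
      algebraMap k Q (counit (R := k) b)) :
    LinearMap.mul' k Q (S.rTensor Q (comul (R := k) (a * b))) =
      algebraMap k Q (counit (R := k) (a * b)) := by
  rw [← (ℛ k a).eq] at ha
  rw [← (ℛ k b).eq] at hb
  rw [Bialgebra.comul_mul, Bialgebra.counit_mul, ← (ℛ k a).eq, ← (ℛ k b).eq]
  simp only [map_sum, LinearMap.rTensor_tmul, LinearMap.mul'_apply] at ha hb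
  simp only [Finset.sum_mul_sum, Algebra.TensorProduct.tmul_mul_tmul, map_sum,
    LinearMap.rTensor_tmul, LinearMap.mul'_apply, hS]
  rw [Finset.sum_comm, map_mul, ← hb, Finset.mul_sum]
  refine Finset.sum_congr rfl fun j _ => ?_
  rw [← Algebra.left_comm, ← ha, Finset.sum_mul, Finset.mul_sum]
  refine Finset.sum_congr rfl fun i _ => ?_
  simp only [mul_assoc]

/-- The right antipode axiom for an antimultiplicative map passes to products. -/
theorem antipode_right_mul (hS : ∀ a b, S (a * b) = S b * S a) {a b : Q}
    (ha : LinearMap.mul' k Q (S.lTensor Q (comul (R := k) a)) = algebraMap k Q (counit (R := k) a))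
    (hb : LinearMap.mul' k Q (S.lTensor Q (comul (R := k) b)) =
      algebraMap k Q (counit (R := k) b)) :
    LinearMap.mul' k Q (S.lTensor Q (comul (R := k) (a * b))) =
      algebraMap k Q (counit (R := k) (a * b)) := by
  rw [← (ℛ k a).eq] at ha
  rw [← (ℛ k b).eq] at hb
  rw [Bialgebra.comul_mul, Bialgebra.counit_mul, ← (ℛ k a).eq, ← (ℛ k b).eq]
  simp only [map_sum, LinearMap.lTensor_tmul, LinearMap.mul'_apply] at ha hb
  simp only [Finset.sum_mul_sum, Algebra.TensorProduct.tmul_mul_tmul, map_sum,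
    LinearMap.lTensor_tmul, LinearMap.mul'_apply, hS]
  rw [map_mul, ← ha, Finset.sum_mul]
  refine Finset.sum_congr rfl fun i _ => ?_
  rw [mul_assoc, ← Algebra.commutes, ← hb, Finset.sum_mul, Finset.mul_sum]
  refine Finset.sum_congr rfl fun j _ => ?_
  simp only [mul_assoc]

/-- The left antipode axiom holds for scalars. -/
theorem antipode_left_algebraMap (hS : ∀ r : k, S (algebraMap k Q r) = algebraMap k Q r) (r : k) :
    LinearMap.mul' k Q (S.rTensor Q (comul (R := k) (algebraMap k Q r))) =
      algebraMap k Q (counit (R := k) (algebraMap k Q r)) := by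
  rw [Bialgebra.comul_algebraMap, Bialgebra.counit_algebraMap]
  simp [Algebra.TensorProduct.algebraMap_apply, hS]

/-- The right antipode axiom holds for scalars. -/
theorem antipode_right_algebraMap (hS : ∀ r : k, S (algebraMap k Q r) = algebraMap k Q r) (r : k) :
    LinearMap.mul' k Q (S.lTensor Q (comul (R := k) (algebraMap k Q r))) =
      algebraMap k Q (counit (R := k) (algebraMap k Q r)) := by
  have h1 : S 1 = 1 := by simpa using hS 1
  rw [Bialgebra.comul_algebraMap, Bialgebra.counit_algebraMap]
  simp [Algebra.TensorProduct.algebraMap_apply, h1]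

end General

section TensorBialgebra

variable (k : Type u) (V : Type v) [Field k] [AddCommGroup V] [Module k V] [Coalgebra k V]

/-- The algebra map `T(V) → T(V) ⊗ T(V)` that extends the comultiplication of `V`. -/
def tensorComul : TensorAlgebra k V →ₐ[k] TensorAlgebra k V ⊗[k] TensorAlgebra k V :=
  TensorAlgebra.lift k
    (TensorProduct.map (TensorAlgebra.ι k) (TensorAlgebra.ι k) ∘ₗ (comul : V →ₗ[k] V ⊗[k] V))

/-- The algebra map `T(V) → k` that extends the counit of `V`. -/
def tensorCounit : TensorAlgebra k V →ₐ[k] k := TensorAlgebra.lift k (counit : V →ₗ[k] k)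

theorem tensorComul_ι (x : V) : tensorComul k V (TensorAlgebra.ι k x) =
    TensorProduct.map (TensorAlgebra.ι k) (TensorAlgebra.ι k) (comul (R := k) x) := by
  simp [tensorComul]

theorem tensorCounit_ι (x : V) :
    tensorCounit k V (TensorAlgebra.ι k x) = counit (R := k) x := by
  simp [tensorCounit]

/-- The bialgebra structure on the tensor algebra of a coalgebra `V` for which `V → T(V)` is a map
of coalgebras. -/
instance tensorBialgebra : Bialgebra k (TensorAlgebra k V) :=
  .ofAlgHom (tensorComul k V) (tensorCounit k V)
    (by
      ext x
      have h := sum_tmul_tmul_eq (R := k) (ℛ k x) (fun i => ℛ k ((ℛ k x).left i))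
        (fun i => ℛ k ((ℛ k x).right i))
      have h2 := congrArg (TensorProduct.map (TensorAlgebra.ι k)
        (TensorProduct.map (TensorAlgebra.ι k) (TensorAlgebra.ι k))) h
      simp only [map_sum, TensorProduct.map_tmul] at h2
      have hl : ∀ y : V, tensorComul k V (TensorAlgebra.ι k y) = ∑ j ∈ (ℛ k y).index,
          TensorAlgebra.ι k ((ℛ k y).left j) ⊗ₜ[k] TensorAlgebra.ι k ((ℛ k y).right j) := by
        intro y
        rw [tensorComul_ι, ← (ℛ k y).eq]
        simp
      simp only [LinearMap.comp_apply, AlgHom.toLinearMap_apply, AlgHom.comp_apply]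
      rw [hl x]
      simp only [map_sum, Algebra.TensorProduct.map_tmul, AlgHom.id_apply, hl,
        TensorProduct.tmul_sum, TensorProduct.sum_tmul]
      simpa using h2)
    (by
      ext x
      have h := congrArg (TensorProduct.map LinearMap.id (TensorAlgebra.ι k))
        (sum_counit_tmul_eq (ℛ k x))
      simp only [map_sum, TensorProduct.map_tmul, LinearMap.id_apply] at h
      simp only [LinearMap.comp_apply, AlgHom.toLinearMap_apply, AlgHom.comp_apply]
      rw [tensorComul_ι, ← (ℛ k x).eq]
      simp only [map_sum, TensorProduct.map_tmul, Algebra.TensorProduct.map_tmul,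
        tensorCounit_ι, AlgHom.id_apply]
      exact h)
    (by
      ext x
      have h := congrArg (TensorProduct.map (TensorAlgebra.ι k) LinearMap.id)
        (sum_tmul_counit_eq (ℛ k x))
      simp only [map_sum, TensorProduct.map_tmul, LinearMap.id_apply] at h
      simp only [LinearMap.comp_apply, AlgHom.toLinearMap_apply, AlgHom.comp_apply]
      rw [tensorComul_ι, ← (ℛ k x).eq]
      simp only [map_sum, TensorProduct.map_tmul, Algebra.TensorProduct.map_tmul,
        tensorCounit_ι, AlgHom.id_apply]
      exact h)

theorem comul_ι (x : V) : comul (R := k) (TensorAlgebra.ι k x) =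
    TensorProduct.map (TensorAlgebra.ι k) (TensorAlgebra.ι k) (comul (R := k) x) :=
  tensorComul_ι k V x

theorem counit_ι (x : V) : counit (R := k) (TensorAlgebra.ι k x) = counit (R := k) x :=
  tensorCounit_ι k V x

end TensorBialgebra

section Hopf

variable (k : Type u) (C : Type v) [Field k] [AddCommGroup C] [Module k C]

/-- The coalgebra `C ⊕ C^cop ⊕ C ⊕ C^cop ⊕ ⋯`. -/
abbrev Copies : Type v := Π₀ n : ℕ, Copy k C n

/-- The shift `(x₀, x₁, x₂, …) ↦ (0, x₀, x₁, x₂, …)`. -/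
def shift : Copies k C →ₗ[k] Copies k C :=
  DFinsupp.lsum k fun n => DFinsupp.lsingle (n + 1) ∘ₗ Copy.cast k C n (n + 1)

/-- The antiendomorphism of the tensor algebra that extends the shift, as an algebra map to the
opposite algebra. -/
def antipodeOp : TensorAlgebra k (Copies k C) →ₐ[k] (TensorAlgebra k (Copies k C))ᵐᵒᵖ :=
  TensorAlgebra.lift k ((MulOpposite.opLinearEquiv k).toLinearMap ∘ₗ
    TensorAlgebra.ι k ∘ₗ shift k C)

/-- The antiendomorphism of the tensor algebra that extends the shift, as a linear map. -/
def preAntipode : TensorAlgebra k (Copies k C) →ₗ[k] TensorAlgebra k (Copies k C) :=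
  (MulOpposite.opLinearEquiv k).symm.toLinearMap ∘ₗ (antipodeOp k C).toLinearMap

theorem preAntipode_one : preAntipode k C 1 = 1 := by
  simp [preAntipode]

theorem preAntipode_algebraMap (r : k) :
    preAntipode k C (algebraMap k _ r) = algebraMap k _ r := by
  simp [preAntipode]

theorem preAntipode_mul (a b : TensorAlgebra k (Copies k C)) :
    preAntipode k C (a * b) = preAntipode k C b * preAntipode k C a := by
  simp [preAntipode]

theorem preAntipode_ι (x : Copies k C) :
    preAntipode k C (TensorAlgebra.ι k x) = TensorAlgebra.ι k (shift k C x) := by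
  simp [preAntipode, antipodeOp]

theorem shift_single (n : ℕ) (x : Copy k C n) :
    shift k C (DFinsupp.single n x) = DFinsupp.single (n + 1) (Copy.cast k C n (n + 1) x) := by
  simp [shift]

variable [Coalgebra k C]

/-- `(S * Id)(x)` for `x` in the tensor algebra, where `*` is the convolution product. -/
def leftConv : TensorAlgebra k (Copies k C) →ₗ[k] TensorAlgebra k (Copies k C) :=
  LinearMap.mul' k _ ∘ₗ (preAntipode k C).rTensor _ ∘ₗ comul

/-- `(Id * S)(x)` for `x` in the tensor algebra, where `*` is the convolution product. -/
def rightConv : TensorAlgebra k (Copies k C) →ₗ[k] TensorAlgebra k (Copies k C) :=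
  LinearMap.mul' k _ ∘ₗ (preAntipode k C).lTensor _ ∘ₗ comul

/-- The relations `(S * Id)(x) = ε(x) 1` and `(Id * S)(x) = ε(x) 1`, for `x` in the generating
coalgebra. -/
def relations : Set (TensorAlgebra k (Copies k C)) :=
  {y | ∃ x : Copies k C, y = leftConv k C (TensorAlgebra.ι k x) -
      algebraMap k _ (counit (R := k) x)} ∪
  {y | ∃ x : Copies k C, y = rightConv k C (TensorAlgebra.ι k x) -
      algebraMap k _ (counit (R := k) x)}

/-- The two-sided ideal that the relations generate. -/
def relIdeal : Ideal (TensorAlgebra k (Copies k C)) := (TwoSidedIdeal.span (relations k C)).asIdeal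

instance : (relIdeal k C).IsTwoSided := by unfold relIdeal; infer_instance

/-- The free Hopf algebra `H(C)` generated by the coalgebra `C`: the tensor algebra of
`C ⊕ C^cop ⊕ C ⊕ ⋯` modulo the ideal that makes the shift an antipode. -/
abbrev FreeHopfAlgebra : Type (max u v) := TensorAlgebra k (Copies k C) ⧸ relIdeal k C

theorem leftConv_ι (x : Copies k C) : leftConv k C (TensorAlgebra.ι k x) =
    ∑ i ∈ (ℛ k x).index, TensorAlgebra.ι k (shift k C ((ℛ k x).left i)) *
      TensorAlgebra.ι k ((ℛ k x).right i) := by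
  simp only [leftConv, LinearMap.comp_apply]
  rw [comul_ι, ← (ℛ k x).eq]
  simp [preAntipode_ι]

theorem rightConv_ι (x : Copies k C) : rightConv k C (TensorAlgebra.ι k x) =
    ∑ i ∈ (ℛ k x).index, TensorAlgebra.ι k ((ℛ k x).left i) *
      TensorAlgebra.ι k (shift k C ((ℛ k x).right i)) := by
  simp only [rightConv, LinearMap.comp_apply]
  rw [comul_ι, ← (ℛ k x).eq]
  simp [preAntipode_ι]

theorem counit_shift (x : Copies k C) :
    counit (R := k) (shift k C x) = counit (R := k) x := by
  have h : (counit : Copies k C →ₗ[k] k) ∘ₗ shift k C = counit := by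
    ext n x
    simp only [LinearMap.comp_apply, DFinsupp.lsingle_apply, shift_single, DFinsupp.counit_single]
    rfl
  exact LinearMap.congr_fun h x

theorem comul_shift (x : Copies k C) :
    comul (R := k) (shift k C x) = TensorProduct.map (shift k C) (shift k C)
      (TensorProduct.comm k _ _ (comul (R := k) x)) := by
  have h : (comul : Copies k C →ₗ[k] _) ∘ₗ shift k C =
      TensorProduct.map (shift k C) (shift k C) ∘ₗ
        (TensorProduct.comm k _ _).toLinearMap ∘ₗ comul := by
    ext n x
    simp only [LinearMap.comp_apply, DFinsupp.lsingle_apply, shift_single, DFinsupp.comul_single,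
      Copy.comul_cast_succ, LinearEquiv.coe_coe]
    rw [← (ℛ k x).eq]
    simp [shift_single]
  exact LinearMap.congr_fun h x

/-- A representation of the comultiplication of a shifted element. -/
theorem comul_shift_sum (x : Copies k C) :
    comul (R := k) (shift k C x) = ∑ i ∈ (ℛ k x).index,
      shift k C ((ℛ k x).right i) ⊗ₜ[k] shift k C ((ℛ k x).left i) := by
  rw [comul_shift, ← (ℛ k x).eq]
  simp

open WithConv in
/-- An algebra map vanishes on the ideal if its restriction to the generating coalgebra and the
shift of this restriction are convolution inverses of each other. -/
theorem map_relIdeal {B : Type*} [Ring B] [Algebra k B] (F : TensorAlgebra k (Copies k C) →ₐ[k] B)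
    (hl : toConv (F.toLinearMap ∘ₗ TensorAlgebra.ι k ∘ₗ shift k C) *
      toConv (F.toLinearMap ∘ₗ TensorAlgebra.ι k) = 1)
    (hr : toConv (F.toLinearMap ∘ₗ TensorAlgebra.ι k) *
      toConv (F.toLinearMap ∘ₗ TensorAlgebra.ι k ∘ₗ shift k C) = 1)
    {y : TensorAlgebra k (Copies k C)} (hy : y ∈ relIdeal k C) : F y = 0 := by
  have key : TwoSidedIdeal.span (relations k C) ≤ TwoSidedIdeal.ker F.toRingHom := by
    rw [TwoSidedIdeal.span_le]
    rintro _ (⟨x, rfl⟩ | ⟨x, rfl⟩)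
    · have h := congrArg (fun f => f x) hl
      simp only [(ℛ k x).convMul_apply] at h
      simp only [SetLike.mem_coe, TwoSidedIdeal.mem_ker]
      rw [leftConv_ι]
      simpa [sub_eq_zero] using h
    · have h := congrArg (fun f => f x) hr
      simp only [(ℛ k x).convMul_apply] at h
      simp only [SetLike.mem_coe, TwoSidedIdeal.mem_ker]
      rw [rightConv_ι]
      simpa [sub_eq_zero] using h
  exact (TwoSidedIdeal.mem_ker F.toRingHom).1 (key hy)

/-- The quotient map, as an algebra map. -/
abbrev quotMap : TensorAlgebra k (Copies k C) →ₐ[k] FreeHopfAlgebra k C :=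
  Ideal.Quotient.mkₐ k (relIdeal k C)

theorem quotMap_eq_of_relations {a b : TensorAlgebra k (Copies k C)} (h : a - b ∈ relations k C) :
    quotMap k C a = quotMap k C b :=
  Ideal.Quotient.eq.2 (TwoSidedIdeal.mem_asIdeal.2 (TwoSidedIdeal.subset_span h))

theorem quot_left (x : Copies k C) :
    ∑ i ∈ (ℛ k x).index, quotMap k C (TensorAlgebra.ι k (shift k C ((ℛ k x).left i))) *
      quotMap k C (TensorAlgebra.ι k ((ℛ k x).right i)) = algebraMap k _ (counit (R := k) x) := by
  have h := quotMap_eq_of_relations k C (Or.inl ⟨x, rfl⟩)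
  rw [leftConv_ι] at h
  simpa only [map_sum, map_mul, AlgHom.commutes] using h

theorem quot_right (x : Copies k C) :
    ∑ i ∈ (ℛ k x).index, quotMap k C (TensorAlgebra.ι k ((ℛ k x).left i)) *
      quotMap k C (TensorAlgebra.ι k (shift k C ((ℛ k x).right i))) =
        algebraMap k _ (counit (R := k) x) := by
  have h := quotMap_eq_of_relations k C (Or.inr ⟨x, rfl⟩)
  rw [rightConv_ι] at h
  simpa only [map_sum, map_mul, AlgHom.commutes] using h

open WithConv in
theorem quot_left_conv :
    toConv ((quotMap k C).toLinearMap ∘ₗ TensorAlgebra.ι k ∘ₗ shift k C) *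
      toConv ((quotMap k C).toLinearMap ∘ₗ TensorAlgebra.ι k) = 1 := by
  refine WithConv.ext (LinearMap.ext fun x => ?_)
  exact ((ℛ k x).convMul_apply _ _).trans (quot_left k C x)

open WithConv in
theorem quot_right_conv :
    toConv ((quotMap k C).toLinearMap ∘ₗ TensorAlgebra.ι k) *
      toConv ((quotMap k C).toLinearMap ∘ₗ TensorAlgebra.ι k ∘ₗ shift k C) = 1 := by
  refine WithConv.ext (LinearMap.ext fun x => ?_)
  exact ((ℛ k x).convMul_apply _ _).trans (quot_right k C x)

theorem counit_mem {x : TensorAlgebra k (Copies k C)} (hx : x ∈ relIdeal k C) :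
    counit (R := k) x = 0 := by
  have h1 : (Bialgebra.counitAlgHom k (TensorAlgebra k (Copies k C))).toLinearMap ∘ₗ
      TensorAlgebra.ι k = (counit : Copies k C →ₗ[k] k) := by
    ext x; simp [counit_ι]
  have h2 : (Bialgebra.counitAlgHom k (TensorAlgebra k (Copies k C))).toLinearMap ∘ₗ
      TensorAlgebra.ι k ∘ₗ shift k C = (counit : Copies k C →ₗ[k] k) := by
    ext x; simp [counit_ι, counit_shift]
  have h3 : WithConv.toConv (counit : Copies k C →ₗ[k] k) = 1 := rfl
  refine map_relIdeal k C (Bialgebra.counitAlgHom k _) ?_ ?_ hx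
  · rw [h1, h2, h3, one_mul]
  · rw [h1, h2, h3, one_mul]

/-- The comultiplication of the tensor algebra, followed by the quotient map on both factors. -/
def quotComul : TensorAlgebra k (Copies k C) →ₐ[k]
    FreeHopfAlgebra k C ⊗[k] FreeHopfAlgebra k C :=
  (Algebra.TensorProduct.map (quotMap k C) (quotMap k C)).comp (Bialgebra.comulAlgHom k _)

theorem quotComul_mem {x : TensorAlgebra k (Copies k C)} (hx : x ∈ relIdeal k C) :
    quotComul k C x = 0 := by
  have h := conv_tensor (quot_left_conv k C) (quot_right_conv k C)
  have e1 : (quotComul k C).toLinearMap ∘ₗ TensorAlgebra.ι k =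
      TensorProduct.map ((quotMap k C).toLinearMap ∘ₗ TensorAlgebra.ι k)
        ((quotMap k C).toLinearMap ∘ₗ TensorAlgebra.ι k) ∘ₗ comul := by
    refine LinearMap.ext fun x => ?_
    rw [TensorProduct.map_comp]
    exact congrArg _ (comul_ι k _ x)
  have e2 : (quotComul k C).toLinearMap ∘ₗ TensorAlgebra.ι k ∘ₗ shift k C =
      TensorProduct.map ((quotMap k C).toLinearMap ∘ₗ TensorAlgebra.ι k ∘ₗ shift k C)
        ((quotMap k C).toLinearMap ∘ₗ TensorAlgebra.ι k ∘ₗ shift k C) ∘ₗ comulCop k _ := by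
    refine LinearMap.ext fun x => ?_
    rw [← LinearMap.comp_assoc, e1, ← LinearMap.comp_assoc (shift k C),
      TensorProduct.map_comp _ _ (shift k C) (shift k C)]
    exact congrArg _ (comul_shift k C x)
  refine map_relIdeal k C (B := FreeHopfAlgebra k C ⊗[k] FreeHopfAlgebra k C) (quotComul k C)
    ?_ ?_ hx
  · rw [e1, e2]; exact h.1
  · rw [e1, e2]; exact h.2

instance : ((relIdeal k C).restrictScalars k).IsCoideal where
  counit_eq_zero := fun _ hx => counit_mem k C hx
  map_mkQ_comul_eq_zero := fun _ hx => quotComul_mem k C hx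

theorem preAntipode_mem {x : TensorAlgebra k (Copies k C)} (hx : x ∈ relIdeal k C) :
    preAntipode k C x ∈ relIdeal k C := by
  let F : TensorAlgebra k (Copies k C) →ₐ[k]
      (FreeHopfAlgebra k C)ᵐᵒᵖ :=
    (AlgHom.op (quotMap k C)).comp (antipodeOp k C)
  have hF : ∀ x, F x = MulOpposite.op (quotMap k C (preAntipode k C x)) := fun x => rfl
  have h : F x = 0 := by
    have hr := fun x => congrArg (fun f => f (shift k C x)) (quot_right_conv k C)
    have hl := fun x => congrArg (fun f => f (shift k C x)) (quot_left_conv k C)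
    simp only [LinearMap.convMul_apply, LinearMap.convOne_apply, comul_shift_sum,
      counit_shift] at hr hl
    refine map_relIdeal k C F ?_ ?_ hx
    · refine WithConv.ext (LinearMap.ext fun x => ?_)
      refine ((ℛ k x).convMul_apply _ _).trans (MulOpposite.unop_injective ?_)
      refine Eq.trans ?_ (hr x)
      simp [hF, preAntipode_ι]
    · refine WithConv.ext (LinearMap.ext fun x => ?_)
      refine ((ℛ k x).convMul_apply _ _).trans (MulOpposite.unop_injective ?_)
      refine Eq.trans ?_ (hl x)
      simp [hF, preAntipode_ι]
  rw [hF, MulOpposite.op_eq_zero_iff] at h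
  exact Ideal.Quotient.eq_zero_iff_mem.1 h

/-- The antipode of the quotient, induced by the shift. -/
def quotAntipode : FreeHopfAlgebra k C →ₗ[k] FreeHopfAlgebra k C :=
  Submodule.mapQ ((relIdeal k C).restrictScalars k) ((relIdeal k C).restrictScalars k)
    (preAntipode k C) fun _ hx => preAntipode_mem k C hx

theorem quotAntipode_mk (x : TensorAlgebra k (Copies k C)) :
    quotAntipode k C (quotMap k C x) = quotMap k C (preAntipode k C x) := rfl

theorem quotMap_surjective : Function.Surjective (quotMap k C) := Ideal.Quotient.mk_surjective

theorem quotAntipode_mul (a b : FreeHopfAlgebra k C) :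
    quotAntipode k C (a * b) = quotAntipode k C b * quotAntipode k C a := by
  obtain ⟨a, rfl⟩ := quotMap_surjective k C a
  obtain ⟨b, rfl⟩ := quotMap_surjective k C b
  rw [← map_mul, quotAntipode_mk, preAntipode_mul, map_mul, quotAntipode_mk, quotAntipode_mk]

theorem quotAntipode_algebraMap (r : k) :
    quotAntipode k C (algebraMap k _ r) = algebraMap k _ r := by
  rw [← (quotMap k C).commutes, quotAntipode_mk, preAntipode_algebraMap]

theorem comul_quot_ι (x : Copies k C) :
    comul (R := k) (quotMap k C (TensorAlgebra.ι k x)) = ∑ i ∈ (ℛ k x).index,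
      quotMap k C (TensorAlgebra.ι k ((ℛ k x).left i)) ⊗ₜ[k]
        quotMap k C (TensorAlgebra.ι k ((ℛ k x).right i)) := by
  have h : comul (R := k) (quotMap k C (TensorAlgebra.ι k x)) =
      TensorProduct.map (quotMap k C).toLinearMap (quotMap k C).toLinearMap
        (comul (R := k) (TensorAlgebra.ι k x)) := rfl
  rw [h, comul_ι, ← (ℛ k x).eq]
  simp

theorem counit_quot_ι (x : Copies k C) :
    counit (R := k) (quotMap k C (TensorAlgebra.ι k x)) = counit (R := k) x :=
  counit_ι k _ x

theorem quot_induction {P : FreeHopfAlgebra k C → Prop}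
    (halg : ∀ r : k, P (algebraMap k _ r))
    (hι : ∀ x : Copies k C, P (quotMap k C (TensorAlgebra.ι k x)))
    (hmul : ∀ a b, P a → P b → P (a * b)) (hadd : ∀ a b, P a → P b → P (a + b))
    (a : FreeHopfAlgebra k C) : P a := by
  obtain ⟨t, rfl⟩ := quotMap_surjective k C a
  induction t using TensorAlgebra.induction with
  | algebraMap r => rw [AlgHom.commutes]; exact halg r
  | ι x => exact hι x
  | mul a b ha hb => rw [map_mul]; exact hmul _ _ ha hb
  | add a b ha hb => rw [map_add]; exact hadd _ _ ha hb

theorem antipode_left (a : FreeHopfAlgebra k C) :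
    LinearMap.mul' k _ ((quotAntipode k C).rTensor _ (comul (R := k) a)) =
      algebraMap k _ (counit (R := k) a) := by
  induction a using quot_induction with
  | halg r => exact antipode_left_algebraMap (quotAntipode_algebraMap k C) r
  | hι x =>
    rw [comul_quot_ι, counit_quot_ι, ← quot_left]
    simp only [map_sum, LinearMap.rTensor_tmul, LinearMap.mul'_apply, quotAntipode_mk,
      preAntipode_ι]
  | hmul a b ha hb => exact antipode_left_mul (quotAntipode_mul k C) ha hb
  | hadd a b ha hb => simp only [map_add, ha, hb]

theorem antipode_right (a : FreeHopfAlgebra k C) :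
    LinearMap.mul' k _ ((quotAntipode k C).lTensor _ (comul (R := k) a)) =
      algebraMap k _ (counit (R := k) a) := by
  induction a using quot_induction with
  | halg r => exact antipode_right_algebraMap (quotAntipode_algebraMap k C) r
  | hι x =>
    rw [comul_quot_ι, counit_quot_ι, ← quot_right]
    simp only [map_sum, LinearMap.lTensor_tmul, LinearMap.mul'_apply, quotAntipode_mk,
      preAntipode_ι]
  | hmul a b ha hb => exact antipode_right_mul (quotAntipode_mul k C) ha hb
  | hadd a b ha hb => simp only [map_add, ha, hb]

instance : HopfAlgebra k (FreeHopfAlgebra k C) where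
  antipode := quotAntipode k C
  mul_antipode_rTensor_comul := LinearMap.ext fun a => antipode_left k C a
  mul_antipode_lTensor_comul := LinearMap.ext fun a => antipode_right k C a

theorem Copy.comul_mk_zero (x : C) : comul (R := k) (Copy.mk k C 0 x) =
    TensorProduct.map (Copy.mk k C 0) (Copy.mk k C 0) (comul (R := k) x) := by
  have hid : TensorProduct.map (Copy.mk k C 0) (Copy.mk k C 0) =
      (LinearMap.id : C ⊗[k] C →ₗ[k] C ⊗[k] C) := TensorProduct.map_id
  rw [hid, Copy.comul_of_even k C Even.zero]
  rfl

/-- `C` as the `0`-th summand of `C ⊕ C^cop ⊕ C ⊕ ⋯`. -/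
def zeroCopy : C →ₗc[k] Copies k C where
  toLinearMap := DFinsupp.lsingle 0 ∘ₗ Copy.mk k C 0
  counit_comp := LinearMap.ext fun x =>
    DFinsupp.counit_single k ℕ (Copy k C) 0 (Copy.mk k C 0 x)
  map_comp_comul := LinearMap.ext fun x => by
    simp only [LinearMap.comp_apply, DFinsupp.lsingle_apply]
    rw [DFinsupp.comul_single, Copy.comul_mk_zero, TensorProduct.map_comp, LinearMap.comp_apply]

/-- The inclusion of a coalgebra `V` into its tensor algebra. -/
def tensorIncl (V : Type v) [AddCommGroup V] [Module k V] [Coalgebra k V] :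
    V →ₗc[k] TensorAlgebra k V where
  toLinearMap := TensorAlgebra.ι k
  counit_comp := LinearMap.ext fun x => counit_ι k V x
  map_comp_comul := LinearMap.ext fun x => (comul_ι k V x).symm

/-- The canonical coalgebra map `C → H(C)`. -/
def canon : C →ₗc[k] FreeHopfAlgebra k C :=
  (Bialgebra.Quotient.mkBialgHom (R := k) (relIdeal k C) :
    TensorAlgebra k (Copies k C) →ₗc[k] FreeHopfAlgebra k C).comp
      ((tensorIncl k (Copies k C)).comp (zeroCopy k C))

end Hopf

end Takeuchi

section Pointed

universe u v

variable (k : Type u) {C : Type v} [Field k] [AddCommGroup C] [Module k C] [Coalgebra k C]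

/-- A subspace `D` of `C` is a subcoalgebra if `Δ(D) ⊆ D ⊗ D`. -/
def IsSubcoalgebra (D : Submodule k C) : Prop :=
  ∀ x ∈ D, comul (R := k) x ∈ LinearMap.range (TensorProduct.map D.subtype D.subtype)

/-- A subcoalgebra is simple if it is nonzero and its only subcoalgebras are `0` and itself. -/
def IsSimpleSubcoalgebra (D : Submodule k C) : Prop :=
  IsSubcoalgebra k D ∧ D ≠ ⊥ ∧ ∀ E : Submodule k C, IsSubcoalgebra k E → E ≤ D → E = ⊥ ∨ E = D

variable (C)

/-- The coradical: the sum of all simple subcoalgebras. -/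
def coradical : Submodule k C := sSup {D | IsSimpleSubcoalgebra k D}

/-- A coalgebra is pointed if its coradical is spanned by its group-like elements. -/
def IsPointedCoalgebra : Prop := coradical k C = Submodule.span k {g | IsGroupLikeElem k g}

end Pointed

/-- `W^n`: the span of all products of at most `n` elements of `W`. -/
def productsUpTo (k : Type*) {A : Type*} [Field k] [Ring A] [Algebra k A] (W : Submodule k A)
    (n : ℕ) : Submodule k A :=
  Submodule.span k {a | ∃ l : List A, l.length ≤ n ∧ (∀ w ∈ l, w ∈ W) ∧ a = l.prod}

end

/-!
The proof rests on one notion, that of a wedge filtration (`IsWedgeFiltration`): a sequence of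
subspaces `F 0, F 1, …` of a coalgebra such that, modulo the earlier terms, `F m` is a right
comodule with coefficients in `F 0`. Every nonzero subcoalgebra in the span of a wedge filtration
meets `F 0` (`IsWedgeFiltration.inf_ne_bot`). Hence, if `F 0` is spanned by group-like elements,
the coradical of an exhaustively filtered coalgebra is that span
(`IsWedgeFiltration.coradical_eq`), and every group-like element in the span of the filtration is
one of those that span `F 0` (`IsWedgeFiltration.groupLike_mem`). Images under coalgebra maps, sums
and, in a bialgebra, products of wedge filtrations are again wedge filtrations.

A pointed coalgebra has an exhaustive wedge filtration that starts with the span of its group-like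
elements (`IsPointedCoalgebra.exists_isWedgeFiltration`): its terms are the common zeros of the
powers of the ideal `K` of functionals that vanish on the group-like elements. To see that these
exhaust the coalgebra, consider the largest ideal of the dual algebra that annihilates a given
element. It has finite codimension, and the common zeros of a maximal two-sided ideal above it form
a simple subcoalgebra, which is spanned by one group-like element. So `K` lies in all these maximal
ideals, and by the Artin–Wedderburn theorem its image in the finite-dimensional quotient lies in the
Jacobson radical, which is nilpotent.

The free Hopf algebra `H(C)` is generated by the images of `C` and `C^cop`, all of which are
pointed. The products of their filtrations exhaust `H(C)` and start with the span of the group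
generated by `i(G(C))`, so that this span is the coradical. Restricting to products of at most `n`
elements of `i(C)` gives the statement on the group-like elements of `C^n`.

It remains to see that `i(G(C))` generates a free group. A linear map on a pointed coalgebra is
convolution invertible as soon as its values at the group-like elements are
(`IsPointedCoalgebra.isUnit_toConv`): its convolution products with a linear map that inverts these
values have the form `1 - e`, where `e` vanishes on the first term of the filtration, so that the
geometric series of `e` is locally finite. So any linear map
from `C` to an algebra with this property extends to an algebra map on `H(C)`
(`exists_algHom_canon_eq`). A linear map that sends each `g ∈ G(C)` to the corresponding generator of
the free group thus gives a retraction of the map from the group algebra to `H(C)`.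
-/

noncomputable section

namespace Takeuchi

/-! ### Tensor products of subspaces -/

section TensorSubspaces

variable {k : Type*} [Field k] {M N : Type*} [AddCommGroup M] [Module k M] [AddCommGroup N]
  [Module k N]

/-- The contraction of a tensor with a functional on the right factor. -/
def contractRight (M : Type*) [AddCommGroup M] [Module k M] (f : N →ₗ[k] k) :
    M ⊗[k] N →ₗ[k] M :=
  (TensorProduct.rid k M).toLinearMap ∘ₗ f.lTensor M

/-- The contraction of a tensor with a functional on the left factor. -/
def contractLeft (N : Type*) [AddCommGroup N] [Module k N] (f : M →ₗ[k] k) :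
    M ⊗[k] N →ₗ[k] N :=
  (TensorProduct.lid k N).toLinearMap ∘ₗ f.rTensor N

@[simp]
theorem contractRight_tmul (f : N →ₗ[k] k) (m : M) (n : N) :
    contractRight M f (m ⊗ₜ n) = f n • m := by simp [contractRight]

@[simp]
theorem contractLeft_tmul (f : M →ₗ[k] k) (m : M) (n : N) :
    contractLeft N f (m ⊗ₜ n) = f m • n := by simp [contractLeft]

theorem eq_of_contractRight {t u : M ⊗[k] N}
    (h : ∀ f : N →ₗ[k] k, contractRight M f t = contractRight M f u) : t = u := by
  classical
  let b := Module.Basis.ofVectorSpace k N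
  refine (TensorProduct.equivFinsuppOfBasisRight b).injective (Finsupp.ext fun i => ?_)
  have key : ∀ t : M ⊗[k] N,
      TensorProduct.equivFinsuppOfBasisRight b t i = contractRight M (b.coord i) t := by
    intro t
    induction t with
    | zero => simp
    | tmul m n => simp
    | add x y hx hy => simp [hx, hy]
  rw [key, key, h]

theorem eq_of_contractLeft {t u : M ⊗[k] N}
    (h : ∀ f : M →ₗ[k] k, contractLeft N f t = contractLeft N f u) : t = u := by
  refine (TensorProduct.comm k M N).injective (eq_of_contractRight fun f => ?_)
  have key : ∀ t : M ⊗[k] N,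
      contractRight N f (TensorProduct.comm k M N t) = contractLeft N f t := by
    intro t
    induction t with
    | zero => simp
    | tmul m n => simp
    | add x y hx hy => simp [hx, hy]
  rw [key, key, h]

/-- The subspace `P ⊗ Q` of `M ⊗ N`. -/
abbrev tensorSub (P : Submodule k M) (Q : Submodule k N) : Submodule k (M ⊗[k] N) :=
  Submodule.map₂ (TensorProduct.mk k M N) P Q

theorem tmul_mem_tensorSub {P : Submodule k M} {Q : Submodule k N} {m : M} {n : N} (hm : m ∈ P)
    (hn : n ∈ Q) : m ⊗ₜ[k] n ∈ tensorSub P Q :=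
  Submodule.apply_mem_map₂ (TensorProduct.mk k M N) hm hn

theorem range_map_subtype (P : Submodule k M) (Q : Submodule k N) :
    LinearMap.range (TensorProduct.map P.subtype Q.subtype) = tensorSub P Q :=
  TensorProduct.range_mapIncl P Q

theorem map_mem_tensorSub {P : Submodule k M} {Q : Submodule k N} {p : M →ₗ[k] M}
    {q : N →ₗ[k] N} (hp : ∀ x, p x ∈ P) (hq : ∀ x, q x ∈ Q) (t : M ⊗[k] N) :
    TensorProduct.map p q t ∈ tensorSub P Q := by
  induction t with
  | zero => simp
  | tmul m n => exact tmul_mem_tensorSub (hp m) (hq n)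
  | add x y hx hy => rw [map_add]; exact add_mem hx hy

theorem contractRight_map (p : M →ₗ[k] M) (q : N →ₗ[k] N) (f : N →ₗ[k] k) (t : M ⊗[k] N) :
    contractRight M f (TensorProduct.map p q t) = p (contractRight M (f ∘ₗ q) t) := by
  induction t with
  | zero => simp
  | tmul m n => simp
  | add x y hx hy => simp [hx, hy]

theorem contractLeft_map (p : M →ₗ[k] M) (q : N →ₗ[k] N) (f : M →ₗ[k] k) (t : M ⊗[k] N) :
    contractLeft N f (TensorProduct.map p q t) = q (contractLeft N (f ∘ₗ p) t) := by
  induction t with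
  | zero => simp
  | tmul m n => simp
  | add x y hx hy => simp [hx, hy]

/-- A subspace is the range of an idempotent linear map. -/
theorem exists_projection (P : Submodule k M) :
    ∃ p : M →ₗ[k] M, (∀ x, p x ∈ P) ∧ ∀ x ∈ P, p x = x := by
  obtain ⟨g, hg⟩ := P.subtype.exists_leftInverse_of_injective P.ker_subtype
  exact ⟨P.subtype ∘ₗ g, fun x => (g x).2, fun x hx =>
    congrArg P.subtype (LinearMap.congr_fun hg ⟨x, hx⟩)⟩

/-- A tensor whose contractions on both sides lie in `P` and `Q` lies in `P ⊗ Q`. -/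
theorem mem_tensorSub {P : Submodule k M} {Q : Submodule k N} {t : M ⊗[k] N}
    (hP : ∀ f, contractRight M f t ∈ P) (hQ : ∀ f, contractLeft N f t ∈ Q) :
    t ∈ tensorSub P Q := by
  obtain ⟨p, hp, hp'⟩ := exists_projection P
  obtain ⟨q, hq, hq'⟩ := exists_projection Q
  have h1 : TensorProduct.map p LinearMap.id t = t := eq_of_contractRight fun f => by
    rw [contractRight_map]; exact hp' _ (hP _)
  have h2 : TensorProduct.map LinearMap.id q t = t := eq_of_contractLeft fun f => by
    rw [contractLeft_map]; exact hq' _ (hQ _)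
  rw [← h2, ← h1, ← LinearMap.comp_apply, ← TensorProduct.map_comp]
  exact map_mem_tensorSub hp hq t

theorem contractRight_mem {P : Submodule k M} {Q : Submodule k N} {t : M ⊗[k] N}
    (ht : t ∈ tensorSub P Q) (f : N →ₗ[k] k) : contractRight M f t ∈ P := by
  refine (Submodule.map₂_le.2 fun m hm n _ => ?_ : tensorSub P Q ≤ P.comap (contractRight M f)) ht
  simpa using P.smul_mem _ hm

theorem contractLeft_mem {P : Submodule k M} {Q : Submodule k N} {t : M ⊗[k] N}
    (ht : t ∈ tensorSub P Q) (f : M →ₗ[k] k) : contractLeft N f t ∈ Q := by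
  refine (Submodule.map₂_le.2 fun m _ n hn => ?_ : tensorSub P Q ≤ Q.comap (contractLeft N f)) ht
  simpa using Q.smul_mem _ hn

theorem map_le_tensorSub_map {M' N' : Type*} [AddCommGroup M'] [Module k M'] [AddCommGroup N']
    [Module k N'] (f : M →ₗ[k] M') (g : N →ₗ[k] N') (P : Submodule k M) (Q : Submodule k N) :
    (tensorSub P Q).map (TensorProduct.map f g) ≤ tensorSub (P.map f) (Q.map g) := by
  rw [Submodule.map_le_iff_le_comap]
  exact Submodule.map₂_le.2 fun m hm n hn =>
    tmul_mem_tensorSub (Submodule.mem_map_of_mem hm) (Submodule.mem_map_of_mem hn)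

theorem tensorSub_mul_le {A B : Type*} [Ring A] [Algebra k A] [Ring B] [Algebra k B]
    (P P' : Submodule k A) (Q Q' : Submodule k B) :
    tensorSub P Q * tensorSub P' Q' ≤ tensorSub (P * P') (Q * Q') := by
  rw [tensorSub, tensorSub, Submodule.map₂_eq_span_image2, Submodule.map₂_eq_span_image2,
    Submodule.span_mul_span, Submodule.span_le]
  rintro _ ⟨_, ⟨a, ha, b, hb, rfl⟩, _, ⟨a', ha', b', hb', rfl⟩, rfl⟩
  simp only [TensorProduct.mk_apply, Algebra.TensorProduct.tmul_mul_tmul]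
  exact tmul_mem_tensorSub (Submodule.mul_mem_mul ha ha') (Submodule.mul_mem_mul hb hb')

end TensorSubspaces

/-! ### Subcoalgebras and group-like elements -/

section Subcoalgebras

variable {k : Type*} [Field k] {C : Type*} [AddCommGroup C] [Module k C] [Coalgebra k C]

theorem isSubcoalgebra_iff {D : Submodule k C} :
    IsSubcoalgebra k D ↔ ∀ x ∈ D, comul (R := k) x ∈ tensorSub D D := by
  simp only [IsSubcoalgebra, range_map_subtype]

theorem contractRight_counit_comul (x : C) : contractRight C counit (comul (R := k) x) = x := by
  simp [contractRight]

theorem isSubcoalgebra_span_singleton {g : C} (hg : IsGroupLikeElem k g) :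
    IsSubcoalgebra k (k ∙ g) := by
  rw [isSubcoalgebra_iff]
  intro x hx
  obtain ⟨c, rfl⟩ := Submodule.mem_span_singleton.1 hx
  rw [map_smul, hg.comul_eq_tmul_self]
  have := Submodule.mem_span_singleton_self (R := k) g
  exact Submodule.smul_mem _ _ (tmul_mem_tensorSub this this)

theorem isSimpleSubcoalgebra_span_singleton {g : C} (hg : IsGroupLikeElem k g) :
    IsSimpleSubcoalgebra k (k ∙ g) := by
  refine ⟨isSubcoalgebra_span_singleton hg, by simpa using hg.ne_zero, fun E _ hE => ?_⟩
  rcases (nonzero_span_atom g hg.ne_zero).le_iff.1 hE with h | h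
  exacts [Or.inl h, Or.inr h]

theorem span_le_coradical {Γ : Set C} (hΓ : ∀ g ∈ Γ, IsGroupLikeElem k g) :
    Submodule.span k Γ ≤ coradical k C :=
  Submodule.span_le.2 fun g hg =>
    (le_sSup (isSimpleSubcoalgebra_span_singleton (hΓ g hg)) : (k ∙ g) ≤ coradical k C)
      (Submodule.mem_span_singleton_self g)

theorem eq_span_singleton_of_isSimple {D : Submodule k C} (hD : IsSimpleSubcoalgebra k D)
    {g : C} (hg : IsGroupLikeElem k g) (hgD : g ∈ D) : D = k ∙ g := by
  rcases hD.2.2 _ (isSubcoalgebra_span_singleton hg)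
    ((Submodule.span_singleton_le_iff_mem _ _).2 hgD) with h | h
  · exact absurd (Submodule.span_singleton_eq_bot.1 h) hg.ne_zero
  · exact h.symm

/-- Distinct group-like elements are linearly independent, so that a function on them extends to a
linear map. -/
theorem exists_linearMap_groupLike {B : Type*} [AddCommGroup B] [Module k B] (u : C → B) :
    ∃ f : C →ₗ[k] B, ∀ g, IsGroupLikeElem k g → f g = u g := by
  have hli : LinearIndepOn k id {g : C | IsGroupLikeElem k g} := linearIndepOn_isGroupLikeElem
  refine ⟨(Module.Basis.extend hli).constr k fun i => u i, fun g hg => ?_⟩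
  have h := (Module.Basis.extend hli).constr_basis k (fun i => u i)
    ⟨g, Module.Basis.subset_extend hli hg⟩
  rwa [Module.Basis.extend_apply_self] at h

/-- A nonzero element of a subcoalgebra `D` in the span of a set of group-like elements involves
one of them, which then lies in `D`. -/
theorem exists_groupLike_mem {Γ : Set C} (hΓ : ∀ g ∈ Γ, IsGroupLikeElem k g)
    {D : Submodule k C} (hD : IsSubcoalgebra k D) {x : C} (hx : x ∈ D) (hx0 : x ≠ 0)
    (hxΓ : x ∈ Submodule.span k Γ) : ∃ g ∈ Γ, g ∈ D := by
  classical
  obtain ⟨c, hc, rfl⟩ := (Submodule.mem_span_set).1 hxΓ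
  have : c ≠ 0 := by rintro rfl; simp at hx0
  obtain ⟨g, hg⟩ := Finsupp.support_nonempty_iff.2 this
  obtain ⟨f, hf⟩ := exists_linearMap_groupLike (k := k) (C := C) (B := k)
    (fun h => if h = g then 1 else 0)
  refine ⟨g, hc hg, ?_⟩
  -- the functional `f` picks out the coefficient of `g`
  have h1 := contractLeft_mem (isSubcoalgebra_iff.1 hD _ hx) f
  have h2 : contractLeft C f (comul (R := k) (c.sum fun mi r => r • mi)) = c g • g := by
    rw [Finsupp.sum, map_sum, map_sum, Finset.sum_eq_single g]
    · rw [map_smul, (hΓ g (hc hg)).comul_eq_tmul_self, map_smul, contractLeft_tmul,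
        hf g (hΓ g (hc hg))]
      simp
    · intro h hh hne
      rw [map_smul, (hΓ h (hc hh)).comul_eq_tmul_self, map_smul, contractLeft_tmul,
        hf h (hΓ h (hc hh))]
      simp [hne]
    · intro h; exact absurd hg h
  rw [h2] at h1
  exact (D.smul_mem_iff (Finsupp.mem_support_iff.1 hg)).1 h1

end Subcoalgebras

/-! ### Wedge filtrations -/

section Sequences

variable {k : Type*} [Field k] {C : Type*} [AddCommGroup C] [Module k C]

theorem iSup_lt_mono (F : ℕ → Submodule k C) {m n : ℕ} (h : m ≤ n) :
    ⨆ i < m, F i ≤ ⨆ i < n, F i :=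
  iSup₂_le fun i hi => le_iSup₂_of_le i (hi.trans_le h) le_rfl

theorem le_iSup_lt (F : ℕ → Submodule k C) {m n : ℕ} (h : m < n) : F m ≤ ⨆ i < n, F i :=
  le_iSup₂_of_le m h le_rfl

theorem exists_mem_iSup_lt {F : ℕ → Submodule k C} {x : C} (hx : x ∈ ⨆ m, F m) :
    ∃ m, x ∈ ⨆ i < m, F i := by
  have hdir : Directed (· ≤ ·) fun m => ⨆ i < m, F i :=
    (monotone_nat_of_le_succ fun m => iSup_lt_mono F m.le_succ).directed_le
  refine (Submodule.mem_iSup_of_directed _ hdir).1 ?_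
  exact (iSup_le fun m => (le_iSup_lt F m.lt_succ_self).trans
    (le_iSup (fun m => ⨆ i < m, F i) (m + 1)) : ⨆ m, F m ≤ ⨆ m, ⨆ i < m, F i) hx

theorem tensorSub_mono {M N : Type*} [AddCommGroup M] [Module k M] [AddCommGroup N] [Module k N]
    {P P' : Submodule k M} {Q Q' : Submodule k N} (hP : P ≤ P') (hQ : Q ≤ Q') :
    tensorSub P Q ≤ tensorSub P' Q' :=
  Submodule.map₂_le_map₂ hP hQ

end Sequences

section Wedge

variable {k : Type*} [Field k] {C : Type*} [AddCommGroup C] [Module k C] [Coalgebra k C]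

/-- A sequence of subspaces `F 0, F 1, …` is a wedge filtration if, modulo the span of the earlier
terms, `F m` is a right comodule with coefficients in `F 0`:
`Δ(F m) ⊆ (∑_{i < m} F i) ⊗ C + F m ⊗ F 0`.
The sequence is not required to be increasing, and need not exhaust `C`. -/
def IsWedgeFiltration (F : ℕ → Submodule k C) : Prop :=
  ∀ m, (F m).map (comul (R := k)) ≤ tensorSub (⨆ i < m, F i) ⊤ ⊔ tensorSub (F m) (F 0)

theorem IsWedgeFiltration.comul_mem {F : ℕ → Submodule k C} (hF : IsWedgeFiltration F) {m : ℕ}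
    {x : C} (hx : x ∈ ⨆ i < m + 1, F i) :
    comul (R := k) x ∈ tensorSub (⨆ i < m, F i) ⊤ ⊔ tensorSub ⊤ (F 0) := by
  refine (iSup₂_le fun i hi => ?_ : ⨆ i < m + 1, F i ≤ Submodule.comap (comul (R := k))
    (tensorSub (⨆ i < m, F i) ⊤ ⊔ tensorSub ⊤ (F 0))) hx
  rw [← Submodule.map_le_iff_le_comap]
  exact (hF i).trans (sup_le_sup
    (tensorSub_mono (iSup_lt_mono F (Nat.lt_succ_iff.1 hi)) le_rfl)
    (tensorSub_mono le_top le_rfl))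

/-- The first term of a wedge filtration meets every nonzero subcoalgebra `D` in the span of the
filtration. Otherwise some functional `f` vanishes on it and agrees with the counit on `D`; the
contraction of `Δ(x)` with `f` is then `x` for `x ∈ D`, but it lowers the degree. -/
theorem IsWedgeFiltration.inf_ne_bot {F : ℕ → Submodule k C} (hF : IsWedgeFiltration F)
    {D : Submodule k C} (hD : IsSubcoalgebra k D) (hD0 : D ≠ ⊥) (hDF : D ≤ ⨆ m, F m) :
    D ⊓ F 0 ≠ ⊥ := by
  intro hbot
  obtain ⟨f, hf0, hfD⟩ : ∃ f : C →ₗ[k] k, (∀ x ∈ F 0, f x = 0) ∧ ∀ x ∈ D, f x = counit x := by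
    obtain ⟨g, hg⟩ := ((F 0).mkQ ∘ₗ D.subtype).exists_leftInverse_of_injective (by
      rw [LinearMap.ker_comp, Submodule.ker_mkQ]
      exact Submodule.disjoint_iff_comap_eq_bot.1 (disjoint_iff.2 hbot))
    refine ⟨counit ∘ₗ D.subtype ∘ₗ g ∘ₗ (F 0).mkQ, fun x hx => ?_, fun x hx => ?_⟩
    · simp [(Submodule.Quotient.mk_eq_zero (F 0)).2 hx]
    · exact congrArg (fun y : D => (counit (y : C) : k)) (LinearMap.congr_fun hg ⟨x, hx⟩)
  have key : ∀ m, ∀ x ∈ D, x ∈ ⨆ i < m, F i → x = 0 := by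
    intro m
    induction m with
    | zero => intro x _ hx; simpa using hx
    | succ m ih =>
      intro x hxD hx
      refine ih x hxD ?_
      have h1 : contractRight C f (comul (R := k) x) = x := by
        refine Eq.trans ?_ (contractRight_counit_comul (k := k) x)
        have h := isSubcoalgebra_iff.1 hD x hxD
        refine (Submodule.map₂_le.2 fun a _ b hb => ?_ : tensorSub D D ≤
          LinearMap.eqLocus (contractRight C f) (contractRight C counit)) h
        simp [LinearMap.mem_eqLocus, hfD b hb]
      rw [← h1]
      refine (sup_le (Submodule.map₂_le.2 fun a ha b _ => ?_)
        (Submodule.map₂_le.2 fun a _ b hb => ?_) : _ ≤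
          Submodule.comap (contractRight C f) (⨆ i < m, F i)) (hF.comul_mem hx)
      · simpa using Submodule.smul_mem _ _ ha
      · simp [hf0 b hb]
  obtain ⟨x, hxD, hx0⟩ := (Submodule.ne_bot_iff _).1 hD0
  obtain ⟨m, hm⟩ := exists_mem_iSup_lt (hDF hxD)
  exact hx0 (key m x hxD hm)

theorem IsWedgeFiltration.exists_groupLike_mem {F : ℕ → Submodule k C} (hF : IsWedgeFiltration F)
    {Γ : Set C} (hΓ : ∀ g ∈ Γ, IsGroupLikeElem k g) (hF0 : F 0 ≤ Submodule.span k Γ)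
    {D : Submodule k C} (hD : IsSubcoalgebra k D) (hD0 : D ≠ ⊥) (hDF : D ≤ ⨆ m, F m) :
    ∃ g ∈ Γ, g ∈ D := by
  obtain ⟨x, hx, hx0⟩ := (Submodule.ne_bot_iff _).1 (hF.inf_ne_bot hD hD0 hDF)
  exact Takeuchi.exists_groupLike_mem hΓ hD hx.1 hx0 (hF0 hx.2)

/-- If group-like elements span the first term of an exhaustive wedge filtration, then they span
the coradical. -/
theorem IsWedgeFiltration.coradical_eq {F : ℕ → Submodule k C} (hF : IsWedgeFiltration F)
    (htop : ⨆ m, F m = ⊤) {Γ : Set C} (hΓ : ∀ g ∈ Γ, IsGroupLikeElem k g)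
    (hF0 : F 0 ≤ Submodule.span k Γ) : coradical k C = Submodule.span k Γ := by
  refine le_antisymm (sSup_le fun D hD => ?_) (span_le_coradical hΓ)
  obtain ⟨g, hg, hgD⟩ := hF.exists_groupLike_mem hΓ hF0 hD.1 hD.2.1 (by rw [htop]; exact le_top)
  rw [eq_span_singleton_of_isSimple hD (hΓ g hg) hgD, Submodule.span_singleton_le_iff_mem]
  exact Submodule.subset_span hg

/-- A group-like element in the span of a wedge filtration belongs to every set of group-like
elements that spans the first term. -/
theorem IsWedgeFiltration.groupLike_mem {F : ℕ → Submodule k C} (hF : IsWedgeFiltration F)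
    {Γ : Set C} (hΓ : ∀ g ∈ Γ, IsGroupLikeElem k g) (hF0 : F 0 ≤ Submodule.span k Γ)
    {h : C} (hh : IsGroupLikeElem k h) (hhF : h ∈ ⨆ m, F m) : h ∈ Γ := by
  obtain ⟨g, hg, hgh⟩ := hF.exists_groupLike_mem hΓ hF0 (isSubcoalgebra_span_singleton hh)
    (by simpa using hh.ne_zero) ((Submodule.span_singleton_le_iff_mem _ _).2 hhF)
  obtain ⟨c, rfl⟩ := Submodule.mem_span_singleton.1 hgh
  have hc := (hΓ _ hg).counit_eq_one
  rw [map_smul, hh.counit_eq_one, smul_eq_mul, mul_one] at hc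
  rwa [hc, one_smul] at hg

theorem IsWedgeFiltration.iSup {ι : Sort*} {F : ι → ℕ → Submodule k C}
    (hF : ∀ i, IsWedgeFiltration (F i)) : IsWedgeFiltration fun m => ⨆ i, F i m := by
  intro m
  rw [Submodule.map_iSup]
  refine iSup_le fun i => (hF i m).trans (sup_le_sup (tensorSub_mono ?_ le_rfl)
    (tensorSub_mono (le_iSup (fun i => F i m) i) (le_iSup (fun i => F i 0) i)))
  exact iSup₂_mono fun j _ => le_iSup (fun i => F i j) i

theorem IsWedgeFiltration.map {H : Type*} [AddCommGroup H] [Module k H] [Coalgebra k H]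
    {F : ℕ → Submodule k C} (hF : IsWedgeFiltration F) (φ : C →ₗc[k] H) :
    IsWedgeFiltration fun m => (F m).map (φ : C →ₗ[k] H) := by
  intro m
  have h : (comul (R := k)) ∘ₗ (φ : C →ₗ[k] H) =
    TensorProduct.map (φ : C →ₗ[k] H) (φ : C →ₗ[k] H) ∘ₗ comul := φ.map_comp_comul.symm
  rw [← Submodule.map_comp, h, Submodule.map_comp]
  refine (Submodule.map_mono (hF m)).trans ?_
  rw [Submodule.map_sup]
  refine sup_le_sup ((map_le_tensorSub_map _ _ _ _).trans (tensorSub_mono ?_ le_top))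
    (map_le_tensorSub_map _ _ _ _)
  simp only [Submodule.map_iSup, le_rfl]

end Wedge

section WedgeMul

variable {k : Type*} [Field k] {H : Type*} [Ring H] [Bialgebra k H]

/-- The product of two sequences of subspaces, as graded by the total degree. -/
def mulFiltration (F G : ℕ → Submodule k H) (m : ℕ) : Submodule k H :=
  ⨆ (i) (j) (_ : i + j = m), F i * G j

theorem mul_le_mulFiltration (F G : ℕ → Submodule k H) (i j : ℕ) :
    F i * G j ≤ mulFiltration F G (i + j) :=
  le_iSup_of_le i (le_iSup₂_of_le j rfl le_rfl)

theorem mulFiltration_zero (F G : ℕ → Submodule k H) : mulFiltration F G 0 = F 0 * G 0 := by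
  refine le_antisymm (iSup_le fun i => iSup₂_le fun j hij => ?_) (mul_le_mulFiltration F G 0 0)
  obtain ⟨rfl, rfl⟩ : i = 0 ∧ j = 0 := by omega
  exact le_rfl

theorem map_comul_mul (P Q : Submodule k H) : (P * Q).map (comul (R := k)) =
    P.map (comul (R := k)) * Q.map (comul (R := k)) :=
  Submodule.map_mul P Q (Bialgebra.comulAlgHom k H)

theorem IsWedgeFiltration.mul {F G : ℕ → Submodule k H} (hF : IsWedgeFiltration F)
    (hG : IsWedgeFiltration G) : IsWedgeFiltration (mulFiltration F G) := by
  intro m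
  rw [mulFiltration, Submodule.map_le_iff_le_comap]
  refine iSup_le fun i => iSup₂_le fun j hij => ?_
  subst hij
  rw [← Submodule.map_le_iff_le_comap, map_comul_mul]
  refine (mul_le_mul' (hF i) (hG j)).trans ?_
  have low : ∀ {P Q : Submodule k H}, P * Q ≤ ⨆ l < i + j, mulFiltration F G l →
      ∀ R R' : Submodule k H, tensorSub P R * tensorSub Q R' ≤
        tensorSub (⨆ l < i + j, mulFiltration F G l) ⊤ :=
    fun h R R' => (tensorSub_mul_le _ _ _ _).trans (tensorSub_mono h le_top)
  have hle : ∀ a b, a + b < i + j → F a * G b ≤ ⨆ l < i + j, mulFiltration F G l :=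
    fun a b hab => (mul_le_mulFiltration F G a b).trans (le_iSup_lt _ hab)
  rw [Submodule.sup_mul, Submodule.mul_sup, Submodule.mul_sup]
  refine sup_le (sup_le ?_ ?_) (sup_le ?_ ?_)
  · refine le_sup_of_le_left (low ?_ _ _)
    simp only [Submodule.iSup_mul, Submodule.mul_iSup]
    exact iSup₂_le fun b hb => iSup₂_le fun a ha => hle a b (by omega)
  · refine le_sup_of_le_left (low ?_ _ _)
    simp only [Submodule.iSup_mul]
    exact iSup₂_le fun a ha => hle a j (by omega)
  · refine le_sup_of_le_left (low ?_ _ _)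
    simp only [Submodule.mul_iSup]
    exact iSup₂_le fun b hb => hle i b (by omega)
  · refine le_sup_of_le_right ((tensorSub_mul_le _ _ _ _).trans (tensorSub_mono
      (mul_le_mulFiltration F G i j) ?_))
    rw [mulFiltration_zero]

/-- The `r`-fold products of a sequence of subspaces, as graded by the total degree. -/
def powFiltration (F : ℕ → Submodule k H) : ℕ → ℕ → Submodule k H
  | 0 => fun _ => 1
  | r + 1 => mulFiltration F (powFiltration F r)

theorem IsWedgeFiltration.pow {F : ℕ → Submodule k H} (hF : IsWedgeFiltration F) (r : ℕ) :
    IsWedgeFiltration (powFiltration F r) := by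
  induction r with
  | zero =>
    intro m
    refine le_sup_of_le_right ?_
    simp only [powFiltration]
    rw [Submodule.one_eq_span, Submodule.map_span, Submodule.span_le]
    rintro _ ⟨_, rfl, rfl⟩
    rw [Bialgebra.comul_one]
    exact tmul_mem_tensorSub (Submodule.mem_span_singleton_self _)
      (Submodule.mem_span_singleton_self _)
  | succ r ih => exact hF.mul ih

theorem powFiltration_apply_zero (F : ℕ → Submodule k H) (r : ℕ) :
    powFiltration F r 0 = F 0 ^ r := by
  induction r with
  | zero => simp [powFiltration]
  | succ r ih => rw [powFiltration, mulFiltration_zero, ih, pow_succ']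

theorem iSup_mul_iSup_powFiltration_le (F : ℕ → Submodule k H) (r : ℕ) :
    (⨆ m, F m) * ⨆ m, powFiltration F r m ≤ ⨆ m, powFiltration F (r + 1) m := by
  simp only [Submodule.iSup_mul, Submodule.mul_iSup]
  exact iSup_le fun j => iSup_le fun i =>
    (mul_le_mulFiltration F (powFiltration F r) i j).trans
      (le_iSup (powFiltration F (r + 1)) (i + j))

theorem list_prod_mem_iSup_powFiltration {F : ℕ → Submodule k H} {l : List H}
    (hl : ∀ x ∈ l, x ∈ ⨆ m, F m) : l.prod ∈ ⨆ m, powFiltration F l.length m := by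
  induction l with
  | nil => exact Submodule.mem_iSup_of_mem 0 (Submodule.one_le.1 le_rfl)
  | cons a l ih =>
    rw [List.prod_cons]
    exact iSup_mul_iSup_powFiltration_le F l.length (Submodule.mul_mem_mul (hl a (by simp))
      (ih fun x hx => hl x (by simp [hx])))

end WedgeMul

/-! ### The Jacobson radical of an Artinian ring and maximal two-sided ideals -/

section Ring

/-- In an Artinian quotient `Q` of a ring, an element that lies in all maximal two-sided ideals
above the kernel is sent to the Jacobson radical: the semisimple quotient of `Q` is a product of
simple rings. -/
theorem map_mem_jacobson_of_forall_isCoatom {A Q : Type*} [Ring A] [Ring Q] [IsArtinianRing Q]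
    (π : A →+* Q) (hπ : Function.Surjective π) {a : A}
    (h : ∀ N : TwoSidedIdeal A, IsCoatom N → (∀ b, π b = 0 → b ∈ N) → a ∈ N) :
    π a ∈ Ring.jacobson Q := by
  obtain ⟨n, D, d, _, _, ⟨e⟩⟩ :=
    IsSemisimpleRing.exists_ringEquiv_pi_matrix_divisionRing (Q ⧸ Ring.jacobson Q)
  rw [← Ideal.Quotient.eq_zero_iff_mem, ← e.map_eq_zero_iff]
  funext i
  let ψ : A →+* Matrix (Fin (d i)) (Fin (d i)) (D i) :=
    (((Pi.evalRingHom _ i).comp e.toRingHom).comp (Ideal.Quotient.mk (Ring.jacobson Q))).comp π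
  have hψ : Function.Surjective ψ :=
    (((Function.surjective_eval i).comp e.surjective).comp Ideal.Quotient.mk_surjective).comp hπ
  have hmem : a ∈ TwoSidedIdeal.ker ψ := by
    refine h _ ⟨fun htop => ?_, fun T hT => ?_⟩ fun b hb => ?_
    · have : (1 : A) ∈ TwoSidedIdeal.ker ψ := by rw [htop]; trivial
      rw [TwoSidedIdeal.mem_ker, map_one] at this
      exact one_ne_zero this
    · obtain ⟨hle, t, htT, htN⟩ := Set.ssubset_iff_exists.1 hT
      let T' : TwoSidedIdeal (Matrix (Fin (d i)) (Fin (d i)) (D i)) :=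
        TwoSidedIdeal.mk' (ψ '' T) ⟨0, T.zero_mem, map_zero _⟩
          (by rintro _ _ ⟨x, hx, rfl⟩ ⟨y, hy, rfl⟩; exact ⟨x + y, T.add_mem hx hy, map_add ..⟩)
          (by rintro _ ⟨x, hx, rfl⟩; exact ⟨-x, T.neg_mem hx, map_neg ..⟩)
          (by
            rintro x _ ⟨y, hy, rfl⟩
            obtain ⟨x, rfl⟩ := hψ x
            exact ⟨x * y, T.mul_mem_left _ _ hy, map_mul ..⟩)
          (by
            rintro _ y ⟨x, hx, rfl⟩
            obtain ⟨y, rfl⟩ := hψ y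
            exact ⟨x * y, T.mul_mem_right _ _ hx, map_mul ..⟩)
      have hT' : ∀ x, x ∈ T' ↔ x ∈ ψ '' T := fun x => TwoSidedIdeal.mem_mk' ..
      -- the image of a strictly larger ideal `T` is a nonzero ideal of a simple ring
      have h1 : (1 : Matrix (Fin (d i)) (Fin (d i)) (D i)) ∈ T' := by
        refine IsSimpleRing.one_mem_of_ne_zero_mem (x := ψ t) T' ?_ ?_
        · exact fun h0 => htN ((TwoSidedIdeal.mem_ker ψ).2 h0)
        · exact (hT' _).2 ⟨t, htT, rfl⟩
      obtain ⟨u, hu, hu1⟩ := (hT' 1).1 h1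
      have h2 : 1 - u ∈ T :=
        hle ((TwoSidedIdeal.mem_ker ψ).2 (by rw [map_sub, hu1, map_one, sub_self]))
      have h3 : (1 : A) ∈ T := by simpa using T.add_mem h2 hu
      exact T.one_mem_iff.1 h3
    · rw [TwoSidedIdeal.mem_ker]
      simp [ψ, hb]
  exact (TwoSidedIdeal.mem_ker ψ).1 hmem

end Ring

/-! ### The dual algebra of a coalgebra -/

section Dual

variable (k : Type*) [Field k] (C : Type*) [AddCommGroup C] [Module k C] [Coalgebra k C]

/-- The dual algebra of a coalgebra: the linear functionals with the convolution product. A type of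
its own keeps the module structure that it has as an algebra as the only one. -/
def DualAlgebra := WithConv (C →ₗ[k] k)

instance : Ring (DualAlgebra k C) := inferInstanceAs (Ring (WithConv (C →ₗ[k] k)))

instance : Algebra k (DualAlgebra k C) := inferInstanceAs (Algebra k (WithConv (C →ₗ[k] k)))

/-- The elements of the dual algebra as linear functionals. -/
def dualEquiv : DualAlgebra k C ≃ₗ[k] (C →ₗ[k] k) where
  toFun a := WithConv.ofConv a
  invFun f := WithConv.toConv f
  map_add' _ _ := rfl
  map_smul' _ _ := rfl
  left_inv _ := rfl
  right_inv _ := rfl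

instance : FunLike (DualAlgebra k C) C k where
  coe a := dualEquiv k C a
  coe_injective _ _ h := (dualEquiv k C).injective (DFunLike.coe_injective h)

instance : LinearMapClass (DualAlgebra k C) k C k where
  map_add a := map_add (dualEquiv k C a)
  map_smulₛₗ a := map_smul (dualEquiv k C a)

variable {k C}

/-- The linear functional `f` as an element of the dual algebra. -/
def toDual (f : C →ₗ[k] k) : DualAlgebra k C := (dualEquiv k C).symm f

@[simp]
theorem toDual_apply (f : C →ₗ[k] k) (x : C) : toDual f x = f x := rfl

theorem dualEquiv_apply (a : DualAlgebra k C) (x : C) : dualEquiv k C a x = a x := rfl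

theorem add_dual_apply (a b : DualAlgebra k C) (x : C) : (a + b) x = a x + b x := rfl

theorem neg_dual_apply (a : DualAlgebra k C) (x : C) : (-a) x = -a x := rfl

theorem zero_dual_apply (x : C) : (0 : DualAlgebra k C) x = 0 := rfl

theorem smul_dual_apply (c : k) (a : DualAlgebra k C) (x : C) : (c • a) x = c * a x := rfl

theorem mul_dual_apply (a b : DualAlgebra k C) (x : C) :
    (a * b) x = ∑ i ∈ (ℛ k x).index, a ((ℛ k x).left i) * b ((ℛ k x).right i) :=
  (ℛ k x).convMul_apply (A := k) _ _

theorem mul_dual_apply_groupLike (a b : DualAlgebra k C) {g : C} (hg : IsGroupLikeElem k g) :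
    (a * b) g = a g * b g := by
  refine (LinearMap.convMul_apply (A := k) _ _ g).trans ?_
  rw [hg.comul_eq_tmul_self]
  rfl

theorem mul_dual_apply_right (a b : DualAlgebra k C) (x : C) :
    (a * b) x = a (contractRight C (dualEquiv k C b) (comul (R := k) x)) := by
  rw [mul_dual_apply]
  conv_rhs => rw [← (ℛ k x).eq]
  simp [mul_comm, dualEquiv_apply]

theorem mul_dual_apply_left (a b : DualAlgebra k C) (x : C) :
    (a * b) x = b (contractLeft C (dualEquiv k C a) (comul (R := k) x)) := by
  rw [mul_dual_apply]
  conv_rhs => rw [← (ℛ k x).eq]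
  simp [dualEquiv_apply]

/-- The functionals that vanish on `D`. -/
def annihilator (D : Submodule k C) : Submodule k (DualAlgebra k C) where
  carrier := {a | ∀ x ∈ D, a x = 0}
  add_mem' ha hb x hx := by rw [add_dual_apply, ha x hx, hb x hx, add_zero]
  zero_mem' x _ := zero_dual_apply x
  smul_mem' c a ha x hx := by rw [smul_dual_apply, ha x hx, mul_zero]

/-- The common zeros of the functionals in `N`. -/
def coannihilator (N : Submodule k (DualAlgebra k C)) : Submodule k C where
  carrier := {x | ∀ a ∈ N, a x = 0}
  add_mem' hx hy a ha := by rw [map_add, hx a ha, hy a ha, add_zero]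
  zero_mem' a _ := map_zero a
  smul_mem' c x hx a ha := by rw [map_smul, hx a ha, smul_zero]

theorem mem_annihilator {D : Submodule k C} {a : DualAlgebra k C} :
    a ∈ annihilator D ↔ ∀ x ∈ D, a x = 0 := Iff.rfl

theorem coannihilator_annihilator (D : Submodule k C) : coannihilator (annihilator D) = D := by
  refine le_antisymm (fun x hx => ?_) fun x hx a ha => ha x hx
  refine (Subspace.forall_mem_dualAnnihilator_apply_eq_zero_iff D x).1 fun f hf => ?_
  exact hx (toDual f) fun y hy => (Submodule.mem_dualAnnihilator f).1 hf y hy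

theorem eq_zero_of_forall_dualAlgebra {x : C} (h : ∀ a : DualAlgebra k C, a x = 0) : x = 0 :=
  (Module.forall_dual_apply_eq_zero_iff k x).1 fun f => h (toDual f)

/-- The restriction of functionals to a subspace. -/
def restrictFunctional (E : Submodule k C) : DualAlgebra k C →ₗ[k] Module.Dual k E where
  toFun a := dualEquiv k C a ∘ₗ E.subtype
  map_add' _ _ := rfl
  map_smul' _ _ := rfl

theorem ker_restrictFunctional (E : Submodule k C) :
    LinearMap.ker (restrictFunctional E) = annihilator E := by
  ext a
  rw [LinearMap.mem_ker, mem_annihilator]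
  exact ⟨fun h x hx => LinearMap.congr_fun h (⟨x, hx⟩ : E), fun h => LinearMap.ext fun x => h x x.2⟩

/-- A space of functionals that contains the annihilator of a finite-dimensional subspace is the
annihilator of its common zeros. -/
theorem annihilator_coannihilator_le {N : Submodule k (DualAlgebra k C)} {E : Submodule k C}
    [FiniteDimensional k E] (hE : annihilator E ≤ N) : annihilator (coannihilator N) ≤ N := by
  intro a ha
  refine (Subspace.forall_mem_dualAnnihilator_apply_eq_zero_iff N a).1 fun f hf => ?_
  have hf' : f ∈ (LinearMap.ker (restrictFunctional E)).dualAnnihilator := by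
    rw [ker_restrictFunctional]
    exact Submodule.dualAnnihilator_anti hE hf
  rw [← LinearMap.range_dualMap_eq_dualAnnihilator_ker] at hf'
  obtain ⟨f', rfl⟩ := hf'
  obtain ⟨y, rfl⟩ := (Module.evalEquiv k E).surjective f'
  have key : ∀ b : DualAlgebra k C,
      (restrictFunctional E).dualMap (Module.evalEquiv k E y) b = b y := fun b => rfl
  rw [key]
  refine ha y fun b hb => ?_
  rw [← key]
  exact (Submodule.mem_dualAnnihilator _).1 hf b hb

end Dual

/-! ### Exhaustive filtrations of pointed coalgebras -/

section Conilpotent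

variable {k : Type*} [Field k] {C : Type*} [AddCommGroup C] [Module k C] [Coalgebra k C]

/-- The common zeros of a two-sided ideal of the dual algebra form a subcoalgebra. -/
theorem isSubcoalgebra_coannihilator {N : Submodule k (DualAlgebra k C)}
    (hl : ∀ a b, b ∈ N → a * b ∈ N) (hr : ∀ a b, a ∈ N → a * b ∈ N) :
    IsSubcoalgebra k (coannihilator N) := by
  rw [isSubcoalgebra_iff]
  refine fun x hx => mem_tensorSub (fun f a ha => ?_) fun f a ha => ?_
  · exact (mul_dual_apply_right a (toDual f) x).symm.trans (hx _ (hr _ _ ha))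
  · exact (mul_dual_apply_left (toDual f) a x).symm.trans (hx _ (hl _ _ ha))

theorem mul_mem_annihilator_left {D : Submodule k C} (hD : IsSubcoalgebra k D)
    (a : DualAlgebra k C) {b : DualAlgebra k C} (hb : b ∈ annihilator D) :
    a * b ∈ annihilator D := fun x hx => by
  rw [mul_dual_apply_left]
  exact hb _ (contractLeft_mem (isSubcoalgebra_iff.1 hD x hx) _)

theorem mul_mem_annihilator_right {D : Submodule k C} (hD : IsSubcoalgebra k D)
    {a : DualAlgebra k C} (b : DualAlgebra k C) (ha : a ∈ annihilator D) :
    a * b ∈ annihilator D := fun x hx => by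
  rw [mul_dual_apply_right]
  exact ha _ (contractRight_mem (isSubcoalgebra_iff.1 hD x hx) _)

/-- A two-sided ideal of the dual algebra as a subspace. -/
def idealSubmodule (N : TwoSidedIdeal (DualAlgebra k C)) : Submodule k (DualAlgebra k C) where
  carrier := N
  add_mem' := N.add_mem
  zero_mem' := N.zero_mem
  smul_mem' c a ha := by
    rw [Algebra.smul_def]
    exact N.mul_mem_left _ _ ha

/-- The annihilator of a subcoalgebra, as a two-sided ideal of the dual algebra. -/
def annihilatorIdeal {D : Submodule k C} (hD : IsSubcoalgebra k D) :
    TwoSidedIdeal (DualAlgebra k C) :=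
  .mk' (annihilator D) (zero_mem _) add_mem neg_mem (mul_mem_annihilator_left hD _)
    (mul_mem_annihilator_right hD _)

theorem mem_annihilatorIdeal {D : Submodule k C} (hD : IsSubcoalgebra k D) {a : DualAlgebra k C} :
    a ∈ annihilatorIdeal hD ↔ a ∈ annihilator D := TwoSidedIdeal.mem_mk' ..

/-- The common zeros of a maximal two-sided ideal that contains the annihilator of a
finite-dimensional subspace form a simple subcoalgebra. -/
theorem isSimpleSubcoalgebra_coannihilator {N : TwoSidedIdeal (DualAlgebra k C)} (hN : IsCoatom N)
    {E : Submodule k C} [FiniteDimensional k E] (hE : annihilator E ≤ idealSubmodule N) :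
    IsSimpleSubcoalgebra k (coannihilator (idealSubmodule N)) := by
  have hle := annihilator_coannihilator_le hE
  refine ⟨isSubcoalgebra_coannihilator (fun a b hb => N.mul_mem_left a b hb)
    (fun a b ha => N.mul_mem_right a b ha), fun hbot => hN.1 ?_, fun D hD hDN => ?_⟩
  · refine N.one_mem_iff.1 (hle ?_)
    rw [hbot]
    intro x hx
    rw [(Submodule.mem_bot k).1 hx]
    exact map_zero (1 : DualAlgebra k C)
  · have hNT : N ≤ annihilatorIdeal hD := fun a ha =>
      (mem_annihilatorIdeal hD).2 fun x hx => hDN hx a ha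
    rcases hN.le_iff.1 hNT with h | h
    · refine Or.inl ((Submodule.eq_bot_iff D).2 fun x hx => eq_zero_of_forall_dualAlgebra
        fun a : DualAlgebra k C => ?_)
      exact (mem_annihilatorIdeal hD).1 (by rw [h]; trivial) x hx
    · refine Or.inr ?_
      rw [← coannihilator_annihilator D]
      congr 1
      ext a
      rw [← mem_annihilatorIdeal hD, h]
      rfl

/-- In a pointed coalgebra, a functional that vanishes on the group-like elements lies in every
maximal two-sided ideal of the dual algebra that contains the annihilator of a finite-dimensional
subspace. -/
theorem _root_.IsPointedCoalgebra.mem_of_isCoatom (hC : IsPointedCoalgebra k C)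
    {N : TwoSidedIdeal (DualAlgebra k C)} (hN : IsCoatom N) {E : Submodule k C}
    [FiniteDimensional k E] (hE : annihilator E ≤ idealSubmodule N) {a : DualAlgebra k C}
    (ha : ∀ g, IsGroupLikeElem k g → a g = 0) : a ∈ N := by
  have hsimple := isSimpleSubcoalgebra_coannihilator hN hE
  obtain ⟨x, hx, hx0⟩ := (Submodule.ne_bot_iff _).1 hsimple.2.1
  have hle : coannihilator (idealSubmodule N) ≤ coradical k C := le_sSup hsimple
  rw [hC] at hle
  obtain ⟨g, hg, hgN⟩ := exists_groupLike_mem (fun g hg => hg) hsimple.1 hx hx0 (hle hx)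
  refine annihilator_coannihilator_le hE ?_
  rw [eq_span_singleton_of_isSimple hsimple hg hgN]
  intro y hy
  obtain ⟨c, rfl⟩ := Submodule.mem_span_singleton.1 hy
  rw [map_smul, ha g hg, smul_zero]

variable (k) in
/-- The largest two-sided ideal of the dual algebra that annihilates `x`. -/
def annihilatorOf (x : C) : TwoSidedIdeal (DualAlgebra k C) :=
  .mk' {a | ∀ b c : DualAlgebra k C, (b * a * c) x = 0} (by intro b c; rw [mul_zero, zero_mul]; rfl)
    (by
      intro a a' ha ha' b c
      rw [mul_add, add_mul, add_dual_apply, ha, ha', add_zero])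
    (by
      intro a ha b c
      rw [mul_neg, neg_mul, neg_dual_apply, ha, neg_zero])
    (by intro a a' ha b c; rw [← mul_assoc b]; exact ha _ _)
    (by intro a a' ha b c; rw [← mul_assoc b, mul_assoc _ a']; exact ha _ _)

theorem mem_annihilatorOf {x : C} {a : DualAlgebra k C} :
    a ∈ annihilatorOf k x ↔ ∀ b c : DualAlgebra k C, (b * a * c) x = 0 := TwoSidedIdeal.mem_mk' ..

variable (k) in
/-- Every element is annihilated by an ideal of finite codimension. -/
theorem exists_annihilator_le_annihilatorOf (x : C) : ∃ E : Submodule k C, FiniteDimensional k E ∧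
    annihilator E ≤ idealSubmodule (annihilatorOf k x) := by
  classical
  refine ⟨Submodule.span k ((ℛ k x).index.biUnion fun i => (ℛ k ((ℛ k x).right i)).index.image
    (ℛ k ((ℛ k x).right i)).left : Finset C), FiniteDimensional.span_finset _ _, fun a ha => ?_⟩
  refine mem_annihilatorOf.2 fun b c => ?_
  rw [mul_assoc, mul_dual_apply]
  refine Finset.sum_eq_zero fun i hi => ?_
  rw [mul_dual_apply, Finset.sum_eq_zero fun j hj => ?_, mul_zero]
  rw [ha _ (Submodule.subset_span ?_), zero_mul]
  simp only [Finset.coe_biUnion, Set.mem_iUnion, Finset.coe_image]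
  exact ⟨i, hi, j, hj, rfl⟩

/-- In a pointed coalgebra, let `K` be a space of functionals that vanish on the group-like elements.
Then a given element is annihilated by some power of `K`, also after multiplication on both sides. -/
theorem _root_.IsPointedCoalgebra.exists_pow_le (hC : IsPointedCoalgebra k C)
    {K : Submodule k (DualAlgebra k C)}
    (hK : ∀ a ∈ K, ∀ g, IsGroupLikeElem k g → a g = 0) (x : C) :
    ∃ n, K ^ (n + 1) ≤ idealSubmodule (annihilatorOf k x) := by
  obtain ⟨E, _, hE⟩ := exists_annihilator_le_annihilatorOf k x
  let I : Ideal (DualAlgebra k C) := (annihilatorOf k x).asIdeal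
  have hI : ∀ a, a ∈ I ↔ a ∈ annihilatorOf k x := fun a => TwoSidedIdeal.mem_asIdeal
  let Q := DualAlgebra k C ⧸ I
  let π : DualAlgebra k C →ₐ[k] Q := Ideal.Quotient.mkₐ k I
  have hπ : ∀ a, π a = 0 ↔ a ∈ annihilatorOf k x := fun a =>
    Ideal.Quotient.eq_zero_iff_mem.trans (hI a)
  have hsurj : Function.Surjective π := Ideal.Quotient.mk_surjective
  have hfin : Module.Finite k Q := by
    have : Module.Finite k (DualAlgebra k C ⧸ LinearMap.ker (restrictFunctional E)) :=
      Module.Finite.equiv (restrictFunctional E).quotKerEquivRange.symm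
    refine Module.Finite.of_surjective
      ((LinearMap.ker (restrictFunctional E)).liftQ π.toLinearMap fun a ha => ?_) ?_
    · rw [ker_restrictFunctional] at ha
      exact (hπ a).2 (hE ha)
    · intro q
      obtain ⟨a, rfl⟩ := hsurj q
      exact ⟨Submodule.Quotient.mk a, rfl⟩
  have hart : IsArtinianRing Q := IsArtinianRing.of_finite k Q
  have hJ : ∀ a ∈ K, π a ∈ Ring.jacobson Q := fun a ha =>
    map_mem_jacobson_of_forall_isCoatom π.toRingHom hsurj fun N hN hker =>
      hC.mem_of_isCoatom hN (fun b hb => hker b ((hπ b).2 (hE hb))) (hK a ha)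
  have hpow : ∀ n, ∀ a ∈ K ^ (n + 1), π a ∈ Ring.jacobson Q ^ (n + 1) := by
    intro n
    induction n with
    | zero => simpa [Submodule.pow_one] using hJ
    | succ n ih =>
      intro a ha
      rw [pow_succ'] at ha
      rw [Ideal.IsTwoSided.pow_succ]
      induction ha using Submodule.mul_induction_on' with
      | mem_mul_mem b hb c hc =>
        rw [map_mul]
        exact Ideal.mul_mem_mul (hJ b hb) (ih c hc)
      | add b _ c _ hb hc => rw [map_add]; exact add_mem hb hc
  obtain ⟨n, hn⟩ : IsNilpotent (Ring.jacobson Q) := IsSemiprimaryRing.isNilpotent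
  refine ⟨n, fun a ha => (hπ a).1 ?_⟩
  have h := hpow n a ha
  rw [Ideal.IsTwoSided.pow_succ, hn, Submodule.zero_eq_bot, Ideal.mul_bot] at h
  exact h

/-- A pointed coalgebra has an exhaustive wedge filtration that starts with the span of the
group-like elements. -/
theorem _root_.IsPointedCoalgebra.exists_isWedgeFiltration (hC : IsPointedCoalgebra k C) :
    ∃ F : ℕ → Submodule k C, IsWedgeFiltration F ∧ ⨆ m, F m = ⊤ ∧
      F 0 = Submodule.span k {g | IsGroupLikeElem k g} := by
  let G : Submodule k C := Submodule.span k {g | IsGroupLikeElem k g}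
  let K := annihilator G
  have hKG : ∀ {a}, (∀ g, IsGroupLikeElem k g → a g = 0) → a ∈ K := fun {a} ha =>
    (Submodule.span_le (p := LinearMap.ker (dualEquiv k C a))).2 ha
  have hKr : K * ⊤ ≤ K := Submodule.mul_le.2 fun a ha b _ => hKG fun g hg => by
    rw [mul_dual_apply_groupLike a b hg, ha g (Submodule.subset_span hg), zero_mul]
  have hKl : ∀ a, ∀ b ∈ K, a * b ∈ K := fun a b hb => hKG fun g hg => by
    rw [mul_dual_apply_groupLike a b hg, hb g (Submodule.subset_span hg), mul_zero]
  have hF0 : coannihilator (K ^ (0 + 1)) = G := by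
    rw [zero_add, pow_one, coannihilator_annihilator]
  refine ⟨fun m => coannihilator (K ^ (m + 1)), ?_, ?_, hF0⟩
  · rintro m _ ⟨x, hx, rfl⟩
    obtain ⟨p, hp, hp'⟩ := exists_projection G
    -- `Δ(x)` is split along a projection `p` onto `G`: a functional composed with `1 - p` lies in
    -- `K`, so that the contraction with it lowers the degree
    have hsplit : comul (R := k) x =
        TensorProduct.map LinearMap.id (LinearMap.id - p) (comul (R := k) x) +
          TensorProduct.map LinearMap.id p (comul (R := k) x) := by
      rw [← LinearMap.add_apply, ← TensorProduct.map_add_right]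
      simp
    rw [hsplit]
    refine Submodule.add_mem_sup (mem_tensorSub (fun f => ?_) fun f => Submodule.mem_top)
      (mem_tensorSub (fun f => ?_) fun f => ?_)
    · rw [contractRight_map, LinearMap.id_apply]
      have hf : toDual (f ∘ₗ (LinearMap.id - p)) ∈ K := hKG fun g hg => by
        simp [hp' g (Submodule.subset_span hg)]
      cases m with
      | zero =>
        suffices h : contractRight C (f ∘ₗ (LinearMap.id - p)) (comul (R := k) x) = 0 by
          rw [h]; exact zero_mem _
        refine eq_zero_of_forall_dualAlgebra fun a : DualAlgebra k C => ?_
        refine (mul_dual_apply_right a (toDual (f ∘ₗ (LinearMap.id - p))) x).symm.trans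
          (hx _ ?_)
        rw [zero_add, pow_one]
        exact hKl _ _ hf
      | succ m =>
        refine le_iSup_lt (fun m => coannihilator (K ^ (m + 1))) m.lt_succ_self fun a ha => ?_
        refine (mul_dual_apply_right a (toDual (f ∘ₗ (LinearMap.id - p))) x).symm.trans
          (hx _ ?_)
        rw [pow_succ]
        exact Submodule.mul_mem_mul ha hf
    · rw [contractRight_map, LinearMap.id_apply]
      intro a ha
      refine (mul_dual_apply_right a (toDual (f ∘ₗ p)) x).symm.trans (hx _ ?_)
      have h : K ^ (m + 1) * ⊤ ≤ K ^ (m + 1) := by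
        rw [pow_succ, mul_assoc]
        exact mul_le_mul' le_rfl hKr
      exact h (Submodule.mul_mem_mul ha trivial)
    · rw [contractLeft_map]
      exact hF0.ge (hp _)
  · refine eq_top_iff.2 fun x _ => ?_
    obtain ⟨n, hn⟩ := hC.exists_pow_le (K := K)
      (fun a ha g hg => ha g (Submodule.subset_span hg)) x
    refine Submodule.mem_iSup_of_mem n fun a ha => ?_
    have := mem_annihilatorOf.1 (hn ha) 1 1
    rwa [one_mul, mul_one] at this

end Conilpotent

/-! ### Convolution inverses -/

section Convolution

open WithConv

variable {k : Type*} [Field k] {C : Type*} [AddCommGroup C] [Module k C]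
  {B : Type*} [Ring B] [Algebra k B]

theorem conv_sub_apply (p q : WithConv (C →ₗ[k] B)) (x : C) : (p - q) x = p x - q x := rfl

theorem conv_sum_apply {ι : Type*} (t : Finset ι) (p : ι → WithConv (C →ₗ[k] B)) (x : C) :
    (∑ i ∈ t, p i) x = ∑ i ∈ t, p i x := by
  let ev : WithConv (C →ₗ[k] B) →+ B :=
    { toFun := fun p => p x, map_zero' := rfl, map_add' := fun _ _ => rfl }
  exact map_sum ev p t

variable [Coalgebra k C]

theorem conv_apply_groupLike (f h : C →ₗ[k] B) {g : C} (hg : IsGroupLikeElem k g) :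
    (toConv f * toConv h) g = f g * h g := by
  rw [LinearMap.convMul_apply, hg.comul_eq_tmul_self]
  rfl

/-- A linear map that vanishes on the first term of a wedge filtration is locally nilpotent for the
convolution product, on the span of the filtration. -/
theorem IsWedgeFiltration.conv_pow_apply_eq_zero {F : ℕ → Submodule k C} (hF : IsWedgeFiltration F)
    {e : C →ₗ[k] B} (he : ∀ x ∈ F 0, e x = 0) {m : ℕ} {x : C} (hx : x ∈ ⨆ i < m, F i) {n : ℕ}
    (hmn : m ≤ n) : (toConv e ^ n) x = 0 := by
  induction m generalizing x n with
  | zero =>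
    rw [(by simpa using hx : x = 0)]
    exact map_zero (toConv e ^ n).ofConv
  | succ m ih =>
    obtain ⟨n, rfl⟩ := Nat.exists_eq_add_of_le' hmn
    rw [← add_assoc, pow_succ, LinearMap.convMul_apply]
    refine (sup_le (Submodule.map₂_le.2 fun a ha b _ => ?_)
      (Submodule.map₂_le.2 fun a _ b hb => ?_) : _ ≤
        LinearMap.ker (LinearMap.mul' k B ∘ₗ TensorProduct.map (toConv e ^ (n + m)).ofConv e))
      (hF.comul_mem hx)
    · have h := ih ha (Nat.le_add_left m n)
      simp [h]
    · simp [he b hb]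

/-- On a coalgebra with an exhaustive wedge filtration, `1 - e` is convolution invertible if the
linear map `e` vanishes on the first term: the inverse is the geometric series. -/
theorem IsWedgeFiltration.isUnit_one_sub {F : ℕ → Submodule k C} (hF : IsWedgeFiltration F)
    (htop : ⨆ m, F m = ⊤) {e : C →ₗ[k] B} (he : ∀ x ∈ F 0, e x = 0) :
    IsUnit (1 - toConv e) := by
  have hex : ∀ x : C, ∃ m, ∀ n, m ≤ n → (toConv e ^ n) x = 0 := fun x => by
    obtain ⟨m, hm⟩ := exists_mem_iSup_lt (show x ∈ ⨆ m, F m by rw [htop]; trivial)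
    exact ⟨m, fun n hn => hF.conv_pow_apply_eq_zero he hm hn⟩
  have hfin : ∀ x : C, (Function.support fun n => (toConv e ^ n) x).Finite := fun x => by
    obtain ⟨m, hm⟩ := hex x
    exact (Set.finite_lt_nat m).subset fun n hn => not_le.1 fun h => hn (hm n h)
  let s : C →ₗ[k] B :=
    { toFun := fun x => ∑ᶠ n, (toConv e ^ n) x
      map_add' := fun x y => by
        rw [← finsum_add_distrib (hfin x) (hfin y)]
        exact finsum_congr fun n => map_add (toConv e ^ n).ofConv x y
      map_smul' := fun c x => by
        rw [RingHom.id_apply, smul_finsum' c (hfin x)]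
        exact finsum_congr fun n => map_smul (toConv e ^ n).ofConv c x }
  have hs : ∀ (x : C) (m : ℕ), (∀ n, m ≤ n → (toConv e ^ n) x = 0) →
      ∀ n, m ≤ n → s x = (∑ i ∈ Finset.range n, toConv e ^ i) x := by
    intro x m hm n hn
    rw [conv_sum_apply]
    refine finsum_eq_sum_of_support_subset _ fun i hi => ?_
    rw [Finset.coe_range, Set.mem_Iio]
    exact not_le.1 fun h => hi (hm i (hn.trans h))
  -- for a given tensor, a finite part of the geometric series gives the values of all factors
  have hrep : ∀ x : C, ∃ n, (1 - toConv e ^ n) x = (1 : WithConv (C →ₗ[k] B)) x ∧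
      (∀ i ∈ (ℛ k x).index, s ((ℛ k x).left i) =
        (∑ i ∈ Finset.range n, toConv e ^ i) ((ℛ k x).left i)) ∧
      ∀ i ∈ (ℛ k x).index, s ((ℛ k x).right i) =
        (∑ i ∈ Finset.range n, toConv e ^ i) ((ℛ k x).right i) := by
    intro x
    choose m hm using hex
    refine ⟨m x + ∑ i ∈ (ℛ k x).index, (m ((ℛ k x).left i) + m ((ℛ k x).right i)), ?_,
      fun i hi => hs _ _ (hm _) _ ?_, fun i hi => hs _ _ (hm _) _ ?_⟩
    · have h := hm x _ (Nat.le_add_right (m x)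
        (∑ i ∈ (ℛ k x).index, (m ((ℛ k x).left i) + m ((ℛ k x).right i))))
      rw [conv_sub_apply, h, sub_zero]
    · have h := Finset.single_le_sum
        (f := fun i => m ((ℛ k x).left i) + m ((ℛ k x).right i)) (fun _ _ => Nat.zero_le _) hi
      exact h.trans' (by simp) |>.trans (Nat.le_add_left _ _)
    · have h := Finset.single_le_sum
        (f := fun i => m ((ℛ k x).left i) + m ((ℛ k x).right i)) (fun _ _ => Nat.zero_le _) hi
      exact h.trans' (by simp) |>.trans (Nat.le_add_left _ _)
  refine ⟨⟨1 - toConv e, toConv s, ?_, ?_⟩, rfl⟩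
  · refine WithConv.ext (LinearMap.ext fun x => ?_)
    obtain ⟨n, h1, _, h2⟩ := hrep x
    refine Eq.trans ?_ h1
    rw [← mul_neg_geom_sum, (ℛ k x).convMul_apply, (ℛ k x).convMul_apply]
    exact Finset.sum_congr rfl fun i hi => congrArg _ (h2 i hi)
  · refine WithConv.ext (LinearMap.ext fun x => ?_)
    obtain ⟨n, h1, h2, _⟩ := hrep x
    refine Eq.trans ?_ h1
    rw [← geom_sum_mul_neg, (ℛ k x).convMul_apply, (ℛ k x).convMul_apply]
    exact Finset.sum_congr rfl fun i hi => congrArg (· * _) (h2 i hi)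

/-- A linear map from a pointed coalgebra to an algebra is convolution invertible if its values at
the group-like elements are invertible. -/
theorem _root_.IsPointedCoalgebra.isUnit_toConv (hC : IsPointedCoalgebra k C) {f : C →ₗ[k] B}
    (hf : ∀ g, IsGroupLikeElem k g → IsUnit (f g)) : IsUnit (toConv f) := by
  obtain ⟨F, hF, htop, hF0⟩ := hC.exists_isWedgeFiltration
  have key : ∀ p q : C →ₗ[k] B, (∀ g, IsGroupLikeElem k g → p g * q g = 1) →
      IsUnit (toConv p * toConv q) := by
    intro p q hpq
    have h := hF.isUnit_one_sub htop (e := (1 - toConv p * toConv q).ofConv) ?_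
    · rwa [toConv_ofConv, sub_sub_cancel] at h
    · rw [hF0]
      refine fun x hx => (Submodule.span_le (p := LinearMap.ker
        (1 - toConv p * toConv q).ofConv)).2 (fun g hg => ?_) hx
      rw [SetLike.mem_coe, LinearMap.mem_ker]
      rw [conv_sub_apply, conv_apply_groupLike p q hg, hpq g hg, LinearMap.convOne_apply,
        IsGroupLikeElem.counit_eq_one hg, map_one, sub_self]
  -- both products of `f` with a linear map that inverts it at the group-like elements are units
  obtain ⟨h, hh⟩ := exists_linearMap_groupLike (k := k) fun g => Ring.inverse (f g)
  obtain ⟨u, hu⟩ := key f h fun g hg => by rw [hh g hg, Ring.mul_inverse_cancel _ (hf g hg)]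
  obtain ⟨v, hv⟩ := key h f fun g hg => by rw [hh g hg, Ring.inverse_mul_cancel _ (hf g hg)]
  refine isUnit_iff_exists_and_exists.2 ⟨⟨toConv h * ↑u⁻¹, ?_⟩, ⟨↑v⁻¹ * toConv h, ?_⟩⟩
  · rw [← mul_assoc, ← hu, Units.mul_inv]
  · rw [mul_assoc, ← hv, Units.inv_mul]

end Convolution

/-! ### Pointedness of the copies of a coalgebra -/

section Transport

variable {k : Type*} [Field k] {C : Type*} [AddCommGroup C] [Module k C] [Coalgebra k C]
  {D : Type*} [AddCommGroup D] [Module k D] [Coalgebra k D]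

/-- A linear equivalence that is an isomorphism or an anti-isomorphism of coalgebras. -/
def IsIsoOrAntiIso (e : C ≃ₗ[k] D) : Prop :=
  (∀ x, counit (R := k) (e x) = counit (R := k) x) ∧
    ((∀ x, comul (R := k) (e x) =
        TensorProduct.map e.toLinearMap e.toLinearMap (comul (R := k) x)) ∨
      ∀ x, comul (R := k) (e x) = TensorProduct.map e.toLinearMap e.toLinearMap
        (TensorProduct.comm k C C (comul (R := k) x)))

theorem IsIsoOrAntiIso.symm {e : C ≃ₗ[k] D} (he : IsIsoOrAntiIso e) : IsIsoOrAntiIso e.symm := by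
  have hid : ∀ t, TensorProduct.map e.symm.toLinearMap e.symm.toLinearMap
      (TensorProduct.map e.toLinearMap e.toLinearMap t) = t := fun t => by
    rw [← LinearMap.comp_apply, ← TensorProduct.map_comp]
    simp
  refine ⟨fun y => ?_, he.2.imp (fun h y => ?_) fun h y => ?_⟩
  · rw [← he.1, e.apply_symm_apply]
  · obtain ⟨x, rfl⟩ := e.surjective y
    rw [h, e.symm_apply_apply, hid]
  · obtain ⟨x, rfl⟩ := e.surjective y
    rw [h, e.symm_apply_apply, TensorProduct.map_comm, hid, ← LinearEquiv.symm_apply_eq]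
    rfl

theorem IsIsoOrAntiIso.isGroupLikeElem {e : C ≃ₗ[k] D} (he : IsIsoOrAntiIso e) {g : C}
    (hg : IsGroupLikeElem k g) : IsGroupLikeElem k (e g) where
  counit_eq_one := by rw [he.1, hg.counit_eq_one]
  comul_eq_tmul_self := by
    rcases he.2 with h | h <;> simp [h, hg.comul_eq_tmul_self]

theorem IsIsoOrAntiIso.isSubcoalgebra {e : C ≃ₗ[k] D} (he : IsIsoOrAntiIso e) {E : Submodule k C}
    (hE : IsSubcoalgebra k E) : IsSubcoalgebra k (E.map e.toLinearMap) := by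
  rw [isSubcoalgebra_iff] at hE ⊢
  rintro _ ⟨x, hx, rfl⟩
  rcases he.2 with h | h
  · exact (h x).symm ▸ map_le_tensorSub_map _ _ _ _ (Submodule.mem_map_of_mem (hE x hx))
  · refine (h x).symm ▸ map_le_tensorSub_map _ _ _ _ (Submodule.mem_map_of_mem ?_)
    exact (Submodule.map₂_le.2 fun a ha b hb => tmul_mem_tensorSub hb ha : tensorSub E E ≤
      (tensorSub E E).comap (TensorProduct.comm k C C).toLinearMap) (hE x hx)

theorem IsIsoOrAntiIso.isSimpleSubcoalgebra {e : C ≃ₗ[k] D} (he : IsIsoOrAntiIso e)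
    {E : Submodule k C} (hE : IsSimpleSubcoalgebra k E) :
    IsSimpleSubcoalgebra k (E.map e.toLinearMap) := by
  refine ⟨he.isSubcoalgebra hE.1, fun h => hE.2.1 ?_, fun E' hE' hle => ?_⟩
  · exact (Submodule.map_eq_bot_iff (e := e)).1 h
  · have hcomap : E'.map e.symm.toLinearMap ≤ E := by
      refine (Submodule.map_mono hle).trans ?_
      rw [← Submodule.map_comp]
      simp
    have hmap : (E'.map e.symm.toLinearMap).map e.toLinearMap = E' := by
      rw [← Submodule.map_comp]
      simp
    rw [← hmap]
    refine (hE.2.2 _ (he.symm.isSubcoalgebra hE') hcomap).imp (fun h => ?_) fun h => ?_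
    · rw [h, Submodule.map_bot]
    · rw [h]

theorem IsIsoOrAntiIso.isPointedCoalgebra {e : C ≃ₗ[k] D} (he : IsIsoOrAntiIso e)
    (hC : IsPointedCoalgebra k C) : IsPointedCoalgebra k D := by
  refine le_antisymm (sSup_le fun E hE => ?_) (span_le_coradical fun g hg => hg)
  have hle : E.map e.symm.toLinearMap ≤ coradical k C :=
    le_sSup (he.symm.isSimpleSubcoalgebra hE)
  rw [hC] at hle
  intro y hy
  have h := Submodule.mem_map_of_mem (f := e.toLinearMap)
    (hle (Submodule.mem_map_of_mem (f := e.symm.toLinearMap) hy))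
  rw [Submodule.map_span] at h
  have h' := Submodule.span_mono (R := k) (t := {g : D | IsGroupLikeElem k g})
    (Set.image_subset_iff.2 fun g hg => he.isGroupLikeElem hg) h
  simpa using h'

end Transport

section CopiesPointed

variable (k : Type*) (C : Type*) [Field k] [AddCommGroup C] [Module k C]

/-- The identity of `C`, as an equivalence of a copy with the next one. -/
def Copy.succEquiv (n : ℕ) : Copy k C n ≃ₗ[k] Copy k C (n + 1) := LinearEquiv.refl k C

/-- The identity of `C`, as an equivalence with the first copy. -/
def Copy.zeroEquiv : C ≃ₗ[k] Copy k C 0 := LinearEquiv.refl k C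

variable [Coalgebra k C]

theorem Copy.isIsoOrAntiIso_succEquiv (n : ℕ) : IsIsoOrAntiIso (Copy.succEquiv k C n) :=
  ⟨fun _ => rfl, Or.inr (Copy.comul_cast_succ k C n)⟩

theorem Copy.isIsoOrAntiIso_zeroEquiv : IsIsoOrAntiIso (Copy.zeroEquiv k C) :=
  ⟨fun _ => rfl, Or.inl (Copy.comul_mk_zero k C)⟩

variable {k C}

theorem Copy.isPointedCoalgebra (hC : IsPointedCoalgebra k C) (n : ℕ) :
    IsPointedCoalgebra k (Copy k C n) := by
  induction n with
  | zero => exact (Copy.isIsoOrAntiIso_zeroEquiv k C).isPointedCoalgebra hC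
  | succ n ih => exact (Copy.isIsoOrAntiIso_succEquiv k C n).isPointedCoalgebra ih

end CopiesPointed

/-! ### Algebra maps out of the free Hopf algebra -/

section Lift

open WithConv

variable {k : Type*} {C : Type*} [Field k] [AddCommGroup C] [Module k C] [Coalgebra k C]
  {B : Type*} [Ring B] [Algebra k B]

/-- A linear map on a copy of a pointed coalgebra that is invertible at group-like elements has a
convolution inverse, which is regarded as a linear map on the next copy. -/
theorem exists_convInverse_next (hC : IsPointedCoalgebra k C) (n : ℕ) {f : Copy k C n →ₗ[k] B}
    (hf : ∀ g, IsGroupLikeElem k g → IsUnit (f g)) :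
    ∃ f' : Copy k C (n + 1) →ₗ[k] B, (∀ g, IsGroupLikeElem k g → IsUnit (f' g)) ∧
      toConv (f' ∘ₗ Copy.cast k C n (n + 1)) * toConv f = 1 ∧
      toConv f * toConv (f' ∘ₗ Copy.cast k C n (n + 1)) = 1 := by
  obtain ⟨v, hr, hl⟩ := isUnit_iff_exists.1 ((Copy.isPointedCoalgebra hC n).isUnit_toConv hf)
  obtain ⟨h, rfl⟩ := WithConv.toConv_surjective v
  let e := Copy.succEquiv k C n
  have he : (h ∘ₗ e.symm.toLinearMap) ∘ₗ Copy.cast k C n (n + 1) = h := rfl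
  refine ⟨h ∘ₗ e.symm.toLinearMap, fun g hg => ?_, by rwa [he], by rwa [he]⟩
  have hg' : IsGroupLikeElem k (e.symm g) :=
    (Copy.isIsoOrAntiIso_succEquiv k C n).symm.isGroupLikeElem hg
  have h1 := congrArg (fun p => p (e.symm g)) hl
  have h2 := congrArg (fun p => p (e.symm g)) hr
  simp only [conv_apply_groupLike _ _ hg', LinearMap.convOne_apply, hg'.counit_eq_one,
    map_one] at h1 h2
  exact isUnit_iff_exists.2 ⟨_, h1, h2⟩

/-- A linear map on a pointed coalgebra `C` that is invertible at group-like elements extends to an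
algebra map on the free Hopf algebra: its values on the `n`-th copy of `C` are iterated convolution
inverses. -/
theorem exists_algHom_canon_eq (hC : IsPointedCoalgebra k C) (f : C →ₗ[k] B)
    (hf : ∀ g, IsGroupLikeElem k g → IsUnit (f g)) :
    ∃ ψ : FreeHopfAlgebra k C →ₐ[k] B, ∀ x, ψ (canon k C x) = f x := by
  let P : ℕ → Type _ := fun n =>
    {f : Copy k C n →ₗ[k] B // ∀ g, IsGroupLikeElem k g → IsUnit (f g)}
  choose next hnext hl hr using fun n (p : P n) => exists_convInverse_next hC n p.2
  let seq : ∀ n, P n := fun n => Nat.rec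
    ⟨f ∘ₗ (Copy.zeroEquiv k C).symm.toLinearMap, fun g hg =>
      hf _ ((Copy.isIsoOrAntiIso_zeroEquiv k C).symm.isGroupLikeElem hg)⟩
    (fun n p => ⟨next n p, hnext n p⟩) n
  have hseq : ∀ n, (seq (n + 1)).1 = next n (seq n) := fun n => rfl
  let F : Copies k C →ₗ[k] B := DFinsupp.lsum k fun n => (seq n).1
  have hF : ∀ n x, F (DFinsupp.single n x) = (seq n).1 x := fun n x => by simp [F]
  have hFs : ∀ n, (F ∘ₗ shift k C) ∘ₗ DFinsupp.lsingle n =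
      (seq (n + 1)).1 ∘ₗ Copy.cast k C n (n + 1) := fun n => LinearMap.ext fun x => by
    simp [shift_single, hF]
  have hF' : ∀ n, F ∘ₗ DFinsupp.lsingle n = (seq n).1 := fun n => LinearMap.ext fun x => by
    simp [hF]
  -- convolution products on the direct sum are computed in each summand
  have hconv : ∀ p q : Copies k C →ₗ[k] B, (∀ n, toConv (p ∘ₗ DFinsupp.lsingle n) *
      toConv (q ∘ₗ DFinsupp.lsingle n) = 1) → toConv p * toConv q = 1 := by
    intro p q h
    refine WithConv.ext (DFinsupp.lhom_ext fun n x => ?_)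
    have h1 := congrArg (fun f => f x) (h n)
    simp only [LinearMap.convMul_apply, LinearMap.convOne_apply] at h1
    rw [LinearMap.convMul_apply, LinearMap.convOne_apply, DFinsupp.comul_single,
      DFinsupp.counit_single, ← h1, ← LinearMap.comp_apply (TensorProduct.map _ _),
      ← TensorProduct.map_comp]
  have hι : (TensorAlgebra.lift k F).toLinearMap ∘ₗ TensorAlgebra.ι k = F := by
    ext; simp
  have hιs : (TensorAlgebra.lift k F).toLinearMap ∘ₗ TensorAlgebra.ι k ∘ₗ shift k C =
      F ∘ₗ shift k C := by
    rw [← LinearMap.comp_assoc, hι]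
  refine ⟨Ideal.Quotient.liftₐ (relIdeal k C) (TensorAlgebra.lift k F) fun a ha =>
    map_relIdeal k C _ ?_ ?_ ha, fun x => ?_⟩
  · rw [hι, hιs]
    refine hconv _ _ fun n => ?_
    rw [hFs, hF', hseq]
    exact hl n (seq n)
  · rw [hι, hιs]
    refine hconv _ _ fun n => ?_
    rw [hFs, hF', hseq]
    exact hr n (seq n)
  · refine Eq.trans (b := TensorAlgebra.lift k F (TensorAlgebra.ι k
      (DFinsupp.single 0 (Copy.mk k C 0 x)))) rfl ?_
    rw [TensorAlgebra.lift_ι_apply, hF]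
    rfl

end Lift

/-! ### Group-like elements and filtrations of the free Hopf algebra -/

section FreeHopf

variable (k : Type*) (C : Type*) [Field k] [AddCommGroup C] [Module k C] [Coalgebra k C]

/-- The coalgebra map from the `n`-th copy of `C` to the free Hopf algebra. -/
def copyIncl (n : ℕ) : Copy k C n →ₗc[k] FreeHopfAlgebra k C :=
  (Bialgebra.Quotient.mkBialgHom (R := k) (relIdeal k C) :
    TensorAlgebra k (Copies k C) →ₗc[k] FreeHopfAlgebra k C).comp
      ((tensorIncl k (Copies k C)).comp
        { toLinearMap := DFinsupp.lsingle n
          counit_comp := DFinsupp.counit_comp_lsingle k ℕ (Copy k C) n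
          map_comp_comul := (DFinsupp.comul_comp_lsingle k ℕ (Copy k C) n).symm })

theorem antipode_copyIncl (n : ℕ) (x : Copy k C n) :
    HopfAlgebra.antipode k (copyIncl k C n x) = copyIncl k C (n + 1) (Copy.succEquiv k C n x) := by
  refine Eq.trans (b := quotMap k C (preAntipode k C (TensorAlgebra.ι k (DFinsupp.single n x))))
    rfl ?_
  rw [preAntipode_ι, shift_single]
  rfl

/-- The images in the free Hopf algebra of the group-like elements of `C`, and their inverses. -/
def groupGenerators : Set (FreeHopfAlgebra k C) :=
  {h | ∃ g : C, IsGroupLikeElem k g ∧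
    (h = canon k C g ∨ (h * canon k C g = 1 ∧ canon k C g * h = 1))}

variable {k C}

theorem isGroupLikeElem_of_mem_groupGenerators {h : FreeHopfAlgebra k C}
    (hh : h ∈ groupGenerators k C) : IsGroupLikeElem k h := by
  obtain ⟨g, hg, rfl | ⟨h1, h2⟩⟩ := hh
  · exact hg.map _
  · exact (hg.map (canon k C)).of_mul_eq_one h2 h1

theorem antipode_mem_groupGenerators {h : FreeHopfAlgebra k C}
    (hh : h ∈ groupGenerators k C) : HopfAlgebra.antipode k h ∈ groupGenerators k C := by
  have hgl := isGroupLikeElem_of_mem_groupGenerators hh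
  obtain ⟨g, hg, rfl | ⟨h1, h2⟩⟩ := hh
  · exact ⟨g, hg, Or.inr ⟨hgl.antipode_mul_cancel, hgl.mul_antipode_cancel⟩⟩
  · exact ⟨g, hg, Or.inl (left_inv_eq_right_inv hgl.antipode_mul_cancel h1)⟩

theorem copyIncl_mem_groupGenerators (n : ℕ) {g : Copy k C n} (hg : IsGroupLikeElem k g) :
    copyIncl k C n g ∈ groupGenerators k C := by
  induction n with
  | zero =>
    exact ⟨_, (Copy.isIsoOrAntiIso_zeroEquiv k C).symm.isGroupLikeElem hg, Or.inl rfl⟩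
  | succ n ih =>
    have h := antipode_mem_groupGenerators
      (ih ((Copy.isIsoOrAntiIso_succEquiv k C n).symm.isGroupLikeElem hg))
    rwa [antipode_copyIncl, LinearEquiv.apply_symm_apply] at h

theorem isGroupLikeElem_of_mem_closure {h : FreeHopfAlgebra k C}
    (hh : h ∈ Submonoid.closure (groupGenerators k C)) : IsGroupLikeElem k h :=
  (Submonoid.closure_le (S := groupLikeSubmonoid k (FreeHopfAlgebra k C))).2
    (fun _ h => isGroupLikeElem_of_mem_groupGenerators h) hh

/-- The images of the copies of `C` generate the free Hopf algebra, so that no proper subspace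
which contains `1` is stable under left multiplication by them. -/
theorem eq_top_of_copyIncl_mul_le {R : Submodule k (FreeHopfAlgebra k C)}
    (h1 : 1 ∈ R) (h : ∀ n x, ∀ y ∈ R, copyIncl k C n x * y ∈ R) : R = ⊤ := by
  refine (Submodule.eq_top_iff').2 fun a => ?_
  suffices key : ∀ y ∈ R, a * y ∈ R by simpa using key 1 h1
  induction a using quot_induction with
  | halg r => intro y hy; rw [← Algebra.smul_def]; exact R.smul_mem r hy
  | hι x =>
    intro y hy
    induction x using DFinsupp.induction with
    | h0 => simp
    | ha n x f _ _ ih =>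
      rw [map_add, map_add, add_mul]
      exact add_mem (h n x y hy) ih
  | hmul a b ha hb => intro y hy; rw [mul_assoc]; exact ha _ (hb y hy)
  | hadd a b ha hb => intro y hy; rw [add_mul]; exact add_mem (ha y hy) (hb y hy)

/-- The products of the wedge filtrations of the copies of `C` form an exhaustive wedge filtration of
the free Hopf algebra, which starts in the span of a group of group-like elements. -/
theorem exists_isWedgeFiltration_freeHopf (hC : IsPointedCoalgebra k C) :
    ∃ F : ℕ → Submodule k (FreeHopfAlgebra k C), IsWedgeFiltration F ∧ ⨆ m, F m = ⊤ ∧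
      F 0 ≤ Submodule.span k (Submonoid.closure (groupGenerators k C)) := by
  choose F hF htop hF0 using fun n => (Copy.isPointedCoalgebra hC n).exists_isWedgeFiltration
  let W : ℕ → Submodule k (FreeHopfAlgebra k C) := fun m =>
    ⨆ n, (F n m).map (copyIncl k C n : Copy k C n →ₗ[k] FreeHopfAlgebra k C)
  have hW : IsWedgeFiltration W := IsWedgeFiltration.iSup fun n => (hF n).map (copyIncl k C n)
  have hW0 : W 0 ≤ Submodule.span k (Submonoid.closure (groupGenerators k C)) := by
    refine iSup_le fun n => ?_
    rw [hF0, Submodule.map_span, Submodule.span_le]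
    rintro _ ⟨g, hg, rfl⟩
    exact Submodule.subset_span (Submonoid.subset_closure (copyIncl_mem_groupGenerators n hg))
  have hWtop : ∀ n x, copyIncl k C n x ∈ ⨆ m, W m := by
    intro n x
    have hx : x ∈ ⨆ m, F n m := by rw [htop]; trivial
    have h := Submodule.mem_map_of_mem
      (f := (copyIncl k C n : Copy k C n →ₗ[k] FreeHopfAlgebra k C)) hx
    rw [Submodule.map_iSup] at h
    exact (iSup_mono fun m => le_iSup (fun n => (F n m).map
      (copyIncl k C n : Copy k C n →ₗ[k] FreeHopfAlgebra k C)) n) h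
  refine ⟨fun m => ⨆ r, powFiltration W r m, IsWedgeFiltration.iSup hW.pow, ?_, ?_⟩
  · refine eq_top_of_copyIncl_mul_le ?_ fun n x y hy => ?_
    · exact Submodule.mem_iSup_of_mem 0 (Submodule.mem_iSup_of_mem 0 (Submodule.one_le.1 le_rfl))
    · rw [iSup_comm] at hy ⊢
      have hle : (⨆ m, W m) * ⨆ r, ⨆ m, powFiltration W r m ≤ ⨆ r, ⨆ m, powFiltration W r m := by
        rw [Submodule.mul_iSup]
        exact iSup_le fun r => (iSup_mul_iSup_powFiltration_le W r).trans
          (le_iSup (fun r => ⨆ m, powFiltration W r m) (r + 1))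
      exact hle (Submodule.mul_mem_mul (hWtop n x) hy)
  · refine iSup_le fun r => ?_
    rw [powFiltration_apply_zero]
    rw [← Algebra.adjoin_eq_span] at hW0 ⊢
    induction r with
    | zero => exact pow_zero (W 0) ▸ Submodule.one_le.2 (one_mem (Algebra.adjoin k _))
    | succ r ih =>
      rw [pow_succ]
      exact Submodule.mul_le.2 fun a ha b hb =>
        (Algebra.adjoin k (groupGenerators k C)).mul_mem (ih ha) (hW0 hb)

end FreeHopf

/-! ### Products of at most `n` elements -/

section Products

variable {k : Type*} [Field k] {H : Type*} [Ring H] [Bialgebra k H]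

theorem list_prod_mem_productsUpTo {W : Submodule k H} {l : List H} (hl : ∀ w ∈ l, w ∈ W) {n : ℕ}
    (hn : l.length ≤ n) : l.prod ∈ productsUpTo k W n :=
  Submodule.subset_span ⟨l, hn, hl, rfl⟩

theorem mul_productsUpTo_le (W : Submodule k H) (n : ℕ) :
    W * productsUpTo k W n ≤ productsUpTo k W (n + 1) := by
  refine Submodule.mul_le.2 fun w hw y hy => ?_
  refine (Submodule.span_le.2 ?_ : productsUpTo k W n ≤
    (productsUpTo k W (n + 1)).comap (LinearMap.mulLeft k w)) hy
  rintro _ ⟨l, hl, hlW, rfl⟩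
  refine Submodule.subset_span ⟨w :: l, by simpa using hl, ?_, by simp⟩
  simpa [hw] using hlW

theorem productsUpTo_mono (W : Submodule k H) {m n : ℕ} (h : m ≤ n) :
    productsUpTo k W m ≤ productsUpTo k W n :=
  Submodule.span_mono fun _ ⟨l, hl, hlW, hx⟩ => ⟨l, hl.trans h, hlW, hx⟩

theorem isSubcoalgebra_productsUpTo {W : Submodule k H} (hW : IsSubcoalgebra k W) (n : ℕ) :
    IsSubcoalgebra k (productsUpTo k W n) := by
  have key : ∀ l : List H, (∀ w ∈ l, w ∈ W) → comul (R := k) l.prod ∈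
      tensorSub (productsUpTo k W l.length) (productsUpTo k W l.length) := by
    intro l
    induction l with
    | nil =>
      intro _
      have h1 : (1 : H) ∈ productsUpTo k W 0 :=
        list_prod_mem_productsUpTo (l := []) (by simp) le_rfl
      rw [List.prod_nil, Bialgebra.comul_one]
      exact tmul_mem_tensorSub h1 h1
    | cons w l ih =>
      intro hl
      rw [List.prod_cons, Bialgebra.comul_mul]
      refine ((tensorSub_mul_le _ _ _ _).trans
        (tensorSub_mono (mul_productsUpTo_le W _) (mul_productsUpTo_le W _)))
        (Submodule.mul_mem_mul (isSubcoalgebra_iff.1 hW w (hl w (by simp)))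
          (ih fun v hv => hl v (by simp [hv])))
  rw [isSubcoalgebra_iff]
  intro x hx
  refine (Submodule.span_le.2 ?_ : productsUpTo k W n ≤ Submodule.comap (comul (R := k))
    (tensorSub (productsUpTo k W n) (productsUpTo k W n))) hx
  rintro _ ⟨l, hl, hlW, rfl⟩
  exact tensorSub_mono (productsUpTo_mono W hl) (productsUpTo_mono W hl) (key l hlW)

theorem isSubcoalgebra_range {C : Type*} [AddCommGroup C] [Module k C] [Coalgebra k C]
    (φ : C →ₗc[k] H) : IsSubcoalgebra k (LinearMap.range (φ : C →ₗ[k] H)) := by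
  rw [isSubcoalgebra_iff]
  rintro _ ⟨x, rfl⟩
  have h : comul (R := k) ((φ : C →ₗ[k] H) x) =
    TensorProduct.map (φ : C →ₗ[k] H) (φ : C →ₗ[k] H) (comul (R := k) x) :=
      (LinearMap.congr_fun φ.map_comp_comul x).symm
  rw [h, LinearMap.range_eq_map]
  refine map_le_tensorSub_map _ _ _ _ (Submodule.mem_map_of_mem ?_)
  rw [tensorSub, TensorProduct.map₂_mk_top_top_eq_top]
  trivial

/-- A group-like element in the span of the products of at most `n` elements of the image of a
pointed coalgebra is a product of at most `n` images of group-like elements. -/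
theorem exists_list_of_isGroupLikeElem {C : Type*} [AddCommGroup C] [Module k C] [Coalgebra k C]
    (hC : IsPointedCoalgebra k C) (φ : C →ₗc[k] H) {n : ℕ} {h : H}
    (hn : h ∈ productsUpTo k (LinearMap.range (φ : C →ₗ[k] H)) n) (hh : IsGroupLikeElem k h) :
    ∃ l : List (GroupLike k C), l.length ≤ n ∧ h = (l.map fun g => φ g.val).prod := by
  obtain ⟨F, hF, htop, hF0⟩ := hC.exists_isWedgeFiltration
  let W : ℕ → Submodule k H := fun m => (F m).map (φ : C →ₗ[k] H)
  have hW : IsWedgeFiltration W := hF.map φ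
  have hWtop : ⨆ m, W m = LinearMap.range (φ : C →ₗ[k] H) := by
    rw [← Submodule.map_iSup, htop, LinearMap.range_eq_map]
  let Γ : Set H :=
    {h | ∃ l : List (GroupLike k C), l.length ≤ n ∧ h = (l.map fun g => φ g.val).prod}
  have hΓ : ∀ g ∈ Γ, IsGroupLikeElem k g := by
    rintro _ ⟨l, _, rfl⟩
    refine list_prod_mem (S := groupLikeSubmonoid k H) fun x hx => ?_
    obtain ⟨g, _, rfl⟩ := List.mem_map.1 hx
    exact g.2.map φ
  have hpow : ∀ r, W 0 ^ r ≤ Submodule.span k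
      {h | ∃ l : List (GroupLike k C), l.length = r ∧ h = (l.map fun g => φ g.val).prod} := by
    intro r
    induction r with
    | zero =>
      rw [pow_zero, Submodule.one_eq_span]
      exact Submodule.span_mono fun x hx => ⟨[], rfl, by simpa using hx⟩
    | succ r ih =>
      rw [pow_succ']
      refine (mul_le_mul' (le_of_eq (congrArg _ hF0)) ih).trans ?_
      rw [Submodule.map_span, Submodule.span_mul_span]
      refine Submodule.span_mono ?_
      rintro _ ⟨_, ⟨g, hg, rfl⟩, _, ⟨l, hl, rfl⟩, rfl⟩
      exact ⟨⟨g, hg⟩ :: l, by simp [hl], by simp⟩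
  refine (IsWedgeFiltration.iSup (ι := Fin (n + 1)) fun r => hW.pow r).groupLike_mem hΓ
    (iSup_le fun r => ?_) hh ?_
  · rw [powFiltration_apply_zero]
    exact (hpow r).trans (Submodule.span_mono fun x ⟨l, hl, hx⟩ =>
      ⟨l, hl.trans_le (Nat.lt_succ_iff.1 r.2), hx⟩)
  · rw [iSup_comm]
    refine (Submodule.span_le.2 ?_ : productsUpTo k (LinearMap.range (φ : C →ₗ[k] H)) n ≤ _) hn
    rintro _ ⟨l, hl, hlW, rfl⟩
    exact Submodule.mem_iSup_of_mem (⟨l.length, Nat.lt_succ_of_le hl⟩ : Fin (n + 1))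
      (list_prod_mem_iSup_powFiltration fun x hx => hWtop ▸ hlW x hx)

end Products

/-! ### The group algebra of the free group -/

section Group

variable (k : Type*) (C : Type*) [Field k] [AddCommGroup C] [Module k C] [Coalgebra k C]

/-- The homomorphism of bialgebras from the group algebra of the free group on the group-like
elements of `C` to the free Hopf algebra, given by the canonical map on the generators. -/
def freeGroupHom :
    MonoidAlgebra k (FreeGroup (GroupLike k C)) →ₐc[k] FreeHopfAlgebra k C :=
  (MonoidAlgebra.liftGroupLikeBialgHom (R := k) (A := FreeHopfAlgebra k C)).comp
    (MonoidAlgebra.mapDomainBialgHom k (FreeGroup.lift fun g : GroupLike k C =>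
      (⟨canon k C g.val, g.2.map (canon k C)⟩ : GroupLike k (FreeHopfAlgebra k C))))

theorem freeGroupHom_single (w : FreeGroup (GroupLike k C)) :
    freeGroupHom k C (MonoidAlgebra.single w 1) = (FreeGroup.lift fun g : GroupLike k C =>
      (⟨canon k C g.val, g.2.map (canon k C)⟩ : GroupLike k (FreeHopfAlgebra k C))) w := by
  simp [freeGroupHom]

theorem freeGroupHom_of (g : GroupLike k C) :
    freeGroupHom k C (MonoidAlgebra.single (FreeGroup.of g) 1) = canon k C g.val := by
  rw [freeGroupHom_single, FreeGroup.lift_apply_of]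

variable {k C}

/-- The map from the group algebra of the free group is injective, since it has a retraction: the
algebra map that extends a linear map on `C` which sends each group-like element to the
corresponding generator. -/
theorem freeGroupHom_injective (hC : IsPointedCoalgebra k C) :
    Function.Injective (freeGroupHom k C) := by
  classical
  obtain ⟨f, hf⟩ := exists_linearMap_groupLike (k := k) (C := C)
    (B := MonoidAlgebra k (FreeGroup (GroupLike k C))) fun g =>
      if hg : IsGroupLikeElem k g then MonoidAlgebra.of k _ (FreeGroup.of ⟨g, hg⟩) else 0
  obtain ⟨ψ, hψ⟩ := exists_algHom_canon_eq hC f fun g hg => by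
    rw [hf g hg, dif_pos hg]
    exact (Group.isUnit _).map _
  let Φ : MonoidAlgebra k (FreeGroup (GroupLike k C)) →ₐ[k] FreeHopfAlgebra k C :=
    freeGroupHom k C
  have hΦ : ∀ g : GroupLike k C, ψ (Φ (MonoidAlgebra.of k _ (FreeGroup.of g))) =
      MonoidAlgebra.of k _ (FreeGroup.of g) := fun g => by
    refine (congrArg ψ (freeGroupHom_of k C g)).trans ?_
    rw [hψ, hf _ g.2, dif_pos g.2]
  have hunits : (((ψ.comp Φ).toRingHom.toMonoidHom).comp
      (MonoidAlgebra.of k (FreeGroup (GroupLike k C)))).toHomUnits =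
      (MonoidAlgebra.of k (FreeGroup (GroupLike k C))).toHomUnits :=
    FreeGroup.ext_hom _ _ fun g => Units.ext (hΦ g)
  have hcomp : ψ.comp Φ = AlgHom.id k _ :=
    MonoidAlgebra.algHom_ext (fun w => congrArg Units.val (DFunLike.congr_fun hunits w))
      (Subsingleton.elim _ _)
  exact Function.LeftInverse.injective (g := ψ) fun x => DFunLike.congr_fun hcomp x

theorem range_freeGroupHom :
    LinearMap.range (freeGroupHom k C : MonoidAlgebra k (FreeGroup (GroupLike k C)) →ₗ[k]
      FreeHopfAlgebra k C) =
        Subalgebra.toSubmodule (Algebra.adjoin k (groupGenerators k C)) := by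
  have hw : ∀ w, freeGroupHom k C (MonoidAlgebra.single w 1) ∈
      Algebra.adjoin k (groupGenerators k C) := by
    intro w
    rw [freeGroupHom_single]
    induction w using FreeGroup.induction_on with
    | C1 => rw [map_one]; exact one_mem _
    | of g =>
      rw [FreeGroup.lift_apply_of]
      exact Algebra.subset_adjoin ⟨g.val, g.2, Or.inl rfl⟩
    | inv_of g _ =>
      rw [map_inv, FreeGroup.lift_apply_of]
      exact Algebra.subset_adjoin (antipode_mem_groupGenerators ⟨g.val, g.2, Or.inl rfl⟩)
    | mul v w hv hw => rw [map_mul]; exact mul_mem hv hw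
  let Φ : MonoidAlgebra k (FreeGroup (GroupLike k C)) →ₐ[k] FreeHopfAlgebra k C :=
    freeGroupHom k C
  refine le_antisymm ?_ (show Algebra.adjoin k (groupGenerators k C) ≤ Φ.range from ?_)
  · rintro _ ⟨x, rfl⟩
    induction x using MonoidAlgebra.induction_on with
    | of w => exact hw w
    | add x y hx hy => rw [map_add]; exact add_mem hx hy
    | smul r x hx => rw [map_smul]; exact Submodule.smul_mem _ r hx
  · refine Algebra.adjoin_le ?_
    rintro h ⟨g, hg, rfl | ⟨h1, _⟩⟩
    · exact ⟨_, freeGroupHom_of k C ⟨g, hg⟩⟩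
    · let γ : FreeGroup (GroupLike k C) := FreeGroup.of ⟨g, hg⟩
      have hγ : Φ (MonoidAlgebra.of k _ γ) = canon k C g := freeGroupHom_of k C ⟨g, hg⟩
      have h2 : canon k C g * Φ (MonoidAlgebra.of k _ γ⁻¹) = 1 := by
        rw [← hγ, ← map_mul Φ, ← map_mul (MonoidAlgebra.of k _), mul_inv_cancel, map_one, map_one]
      exact ⟨_, (left_inv_eq_right_inv h1 h2).symm⟩

end Group

end Takeuchi

end

open Takeuchi in
theorem mainTheorem11 (k : Type*) (C : Type*) [Field k] [AddCommGroup C] [Module k C]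
    [Coalgebra k C] (hC : IsPointedCoalgebra k C) :
    IsPointedCoalgebra k (FreeHopfAlgebra k C) ∧
    coradical k (FreeHopfAlgebra k C) =
      Subalgebra.toSubmodule (Algebra.adjoin k {h : FreeHopfAlgebra k C |
        ∃ g : C, IsGroupLikeElem k g ∧
          (h = canon k C g ∨ (h * canon k C g = 1 ∧ canon k C g * h = 1))}) ∧
    (∃ φ : MonoidAlgebra k (FreeGroup (GroupLike k C)) →ₐc[k] FreeHopfAlgebra k C,
      (∀ g : GroupLike k C, φ (MonoidAlgebra.single (FreeGroup.of g) 1) = canon k C g.val) ∧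
      Function.Injective φ ∧
      LinearMap.range (φ : MonoidAlgebra k (FreeGroup (GroupLike k C)) →ₗ[k]
        FreeHopfAlgebra k C) = coradical k (FreeHopfAlgebra k C)) ∧
    ∀ n : ℕ, 1 ≤ n →
      IsSubcoalgebra k
        (productsUpTo k (LinearMap.range (canon k C : C →ₗ[k] FreeHopfAlgebra k C)) n) ∧
      ∀ h ∈ productsUpTo k (LinearMap.range (canon k C : C →ₗ[k] FreeHopfAlgebra k C)) n,
        IsGroupLikeElem k h →
          ∃ l : List (GroupLike k C), l.length ≤ n ∧
            h = (l.map fun g => canon k C g.val).prod := by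
  obtain ⟨F, hF, htop, hF0⟩ := exists_isWedgeFiltration_freeHopf hC
  have hcorad : coradical k (FreeHopfAlgebra k C) =
      Subalgebra.toSubmodule (Algebra.adjoin k (groupGenerators k C)) := by
    rw [Algebra.adjoin_eq_span]
    exact hF.coradical_eq htop (fun _ h => isGroupLikeElem_of_mem_closure h) hF0
  refine ⟨le_antisymm ?_ (span_le_coradical fun _ h => h), hcorad,
    ⟨freeGroupHom k C, freeGroupHom_of k C, freeGroupHom_injective hC,
      range_freeGroupHom.trans hcorad.symm⟩,
    fun n _ => ⟨isSubcoalgebra_productsUpTo (isSubcoalgebra_range (canon k C)) n,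
      fun h hn hh => exists_list_of_isGroupLikeElem hC (canon k C) hn hh⟩⟩
  rw [hcorad, Algebra.adjoin_eq_span]
  exact Submodule.span_mono fun _ h => isGroupLikeElem_of_mem_closure h
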